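/- **Theorem (asymptotic normality of the GTLS estimator).** Let $p$ and $\beta_0\in\mathbb R^p$ be fixed, and let $N=N_k\to\infty$, $n=n_k\to\infty$ be integers with $N/n\to c$ for some $c>0$. For each $k$ let $X$ be a nonrandom real $N\times p$ matrix with columns $X_1,\dots,X_p$, let $\Sigma$ be an $N\times N$ covariance matrix, let $\epsilon,\nu_1,\dots,\nu_p$ be mutually independent $\mathcal N(0,\Sigma)$ random vectors in $\mathbb R^N$, and put $$Y=X\beta_0+\epsilon,\qquad \tilde X_i=X_i+\nu_i\ (i=1,\dots,p),\qquad \tilde X=(\tilde X_1,\dots,\tilde X_p).$$ Let $\hat\Sigma$ be an almost surely positive definite matrix that is a measurable function of $n$ random vectors $Z_1,\dots,Z_n\in\mathbb R^N$ (control runs) which are jointly independent of $(\epsilon,\nu_1,\dots,\nu_p)$. Let $\hat\beta$ be the generalized total least squares (GTLS) estimator, a random vector with $$\hat\beta\in\arg\min_{\beta\in\mathbb R^p}\frac{\|\hat\Sigma^{-1/2}(Y-\tilde X\beta)\|_2^2}{1+\beta^\top\beta}$$ whenever a minimizer exists (and arbitrary otherwise). Suppose that, as $k\to\infty$, in probability,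 1. $X^\top\hat\Sigma^{-1}X/N\to\Delta_1$ with $\Delta_1$ nonsingular; 2. $\operatorname{Tr}(\hat\Sigma^{-1}\Sigma)/N\to\delta$ for some constant $\delta>0$; 3. $\operatorname{Tr}\{(\hat\Sigma^{-1/2}\Sigma\hat\Sigma^{-1/2})^2\}/N\to K$ for some constant $K>0$; 4. $X^\top\hat\Sigma^{-1}\Sigma\hat\Sigma^{-1}X/N\to\Delta_2$ with $\Delta_2$ nonsingular; 5. $\|\hat\Sigma^{-1/2}\Sigma\hat\Sigma^{-1/2}\|/\sqrt N\to0$, where $\|\cdot\|$ is the spectral norm (this holds in particular if $\|\Sigma\|$ and $\|\hat\Sigma^{-1}\|$ stay bounded). Then, with probability tending to one, the minimizer exists and is unique; the matrix $$\Xi=\Delta_1^{-1}\big\{\Delta_2+K(I_p+\beta_0\beta_0^\top)^{-1}\big\}(1+\beta_0^\top\beta_0)\Delta_1^{-1}$$ is positive semidefinite; and $$\sqrt N(\hat\beta-\beta_0)\overset{\mathcal D}{\longrightarrow}\mathcal N(0,\Xi).$$ -/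

import Mathlib

open MeasureTheory ProbabilityTheory Filter Topology

noncomputable section

namespace GTLS

open scoped MatrixOrder in
/-- The inverse symmetric square root `S^{-1/2}` of a (positive definite) matrix `S`. -/
def invSqrt {N : ℕ} (S : Matrix (Fin N) (Fin N) ℝ) : Matrix (Fin N) (Fin N) ℝ :=
  (CFC.sqrt S)⁻¹

/-- The prewhitened error covariance `S^{-1/2} Σ S^{-1/2}`, where `Sig = Σ`. -/
def whitened {N : ℕ} (S Sig : Matrix (Fin N) (Fin N) ℝ) : Matrix (Fin N) (Fin N) ℝ :=
  invSqrt S * Sig * invSqrt S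

/-- The spectral norm (operator norm with respect to the Euclidean norm). -/
def specNorm {N : ℕ} (A : Matrix (Fin N) (Fin N) ℝ) : ℝ :=
  ‖Matrix.toEuclideanCLM (𝕜 := ℝ) A‖

/-- The response `Y = X β + ε`. -/
def response {N p : ℕ} (X : Matrix (Fin N) (Fin p) ℝ) (β : EuclideanSpace ℝ (Fin p))
    (ε : EuclideanSpace ℝ (Fin N)) : EuclideanSpace ℝ (Fin N) :=
  WithLp.toLp 2 (X.mulVec β.ofLp) + ε

/-- The matrix of observed fingerprints, with `i`-th column `X_i + ν_i`. -/
def observed {N p : ℕ} (X : Matrix (Fin N) (Fin p) ℝ)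
    (ν : Fin p → EuclideanSpace ℝ (Fin N)) : Matrix (Fin N) (Fin p) ℝ :=
  Matrix.of fun r i => X r i + ν i r

/-- The objective `‖S^{-1/2} (Y - Xt b)‖₂² / (1 + bᵀ b)` of generalized total least squares. -/
def objective {N p : ℕ} (S : Matrix (Fin N) (Fin N) ℝ) (Xt : Matrix (Fin N) (Fin p) ℝ)
    (Y : EuclideanSpace ℝ (Fin N)) (b : EuclideanSpace ℝ (Fin p)) : ℝ :=
  ‖(WithLp.toLp 2 ((invSqrt S).mulVec (Y.ofLp - Xt.mulVec b.ofLp)) :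
      EuclideanSpace ℝ (Fin N))‖ ^ 2 / (1 + b.ofLp ⬝ᵥ b.ofLp)

/-- `b` is a value of the `arg min` that defines the GTLS estimator. -/
def IsEstimate {N p : ℕ} (S : Matrix (Fin N) (Fin N) ℝ) (Xt : Matrix (Fin N) (Fin p) ℝ)
    (Y : EuclideanSpace ℝ (Fin N)) (b : EuclideanSpace ℝ (Fin p)) : Prop :=
  ∀ b' : EuclideanSpace ℝ (Fin p), objective S Xt Y b ≤ objective S Xt Y b'

/-- Entrywise convergence in probability of random `p × p` matrices to a constant matrix. -/
def TendstoInProbMatrix {Ω : Type*} [MeasurableSpace Ω] {p : ℕ} (P : Measure Ω)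
    (A : ℕ → Ω → Matrix (Fin p) (Fin p) ℝ) (B : Matrix (Fin p) (Fin p) ℝ) : Prop :=
  ∀ i j, TendstoInMeasure P (fun k ω => A k ω i j) atTop (fun _ => B i j)

/-- `Δ₁⁻¹ {Δ₂ + K (I + β β^T)⁻¹} (1 + β^T β) Δ₁⁻¹`. -/
def asymCov {p : ℕ} (Δ₁ Δ₂ : Matrix (Fin p) (Fin p) ℝ) (K : ℝ)
    (β : EuclideanSpace ℝ (Fin p)) : Matrix (Fin p) (Fin p) ℝ :=
  Δ₁⁻¹ * ((1 + β.ofLp ⬝ᵥ β.ofLp) •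
    (Δ₂ + K • (1 + Matrix.vecMulVec β.ofLp β.ofLp)⁻¹)) * Δ₁⁻¹

end GTLS

end

/-!
Write `B = S⁻¹`, `s = 1 + ‖β₀‖²`, `r = Y - X̃ β₀ = ε - ∑ β₀ⱼ νⱼ` and `d = b - β₀`. Divided by `N`,
the objective at `b` equals `λ + R(d)`, where `λ = rᵀ B r / (N s)` does not depend on `d` and

  `R(d) = (dᵀ C d - 2 hᵀ d) / (1 + ‖β₀ + d‖²)`,
  `C = X̃ᵀ B X̃ / N - λ I`,  `h = X̃ᵀ B r / N + λ β₀`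

(`objective_eq_recentred`). As soon as `C ≥ c I` with `c > 0`, the function `R` has exactly one
minimizer, and the first-order condition reads `C d = h + μ (β₀ + d)`, where the minimal value `μ`
is of order `‖h‖²` (`existsUnique_isMin_recentred`, `norm_apply_sub_le_of_isMin`). Laws of large
numbers for quadratic forms, applied conditionally on `S` through Chebyshev's inequality, give
`λ → δ` and `C → Δ₁` in probability (`PrecisionModel.lim_curvature`). Hence the minimizer is unique
with probability tending to one, and `√N d` is asymptotically equivalent to `Δ₁⁻¹ √N h`.

The central limit theorem for `√N h` (`PrecisionModel.tendstoInDistribution_modelScore`) comes from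
an exact computation. In a direction `t`,

  `√N tᵀ h = ((X t)ᵀ B r + rᵀ B τ) / √N`,  `τ = ∑ tⱼ νⱼ + (tᵀ β₀ / s) r`,

and `τ` is uncorrelated with `r`, hence independent of `(B, r)`. Given `(B, r)`, the second summand
is a centred Gaussian variable with variance `m rᵀ B Σ B r / N`, `m = tᵀ (I + β₀ β₀ᵀ)⁻¹ t`, which
converges in probability to the constant `m s K`; the spectral norm condition enters here, through
the trace of the fourth power of the whitened covariance. Given `B`, the first summand is a centred
Gaussian variable with variance converging to `s tᵀ Δ₂ t`. So the characteristic functions converge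
to that of `N(0, s (Δ₂ + K (I + β₀ β₀ᵀ)⁻¹))`, and Lévy's continuity theorem applies.
-/

namespace GTLS

/-! ### Convergence in probability to a constant -/

section ConvergenceInProbability

variable {Ω : Type*} [MeasurableSpace Ω] {P : Measure Ω}

theorem tendstoInProb_continuousAt {E F : Type*} [PseudoMetricSpace E] [PseudoMetricSpace F]
    {U : ℕ → Ω → E} {c : E} (h : TendstoInMeasure P U atTop (fun _ => c)) {g : E → F}
    (hg : ContinuousAt g c) :
    TendstoInMeasure P (fun k ω => g (U k ω)) atTop (fun _ => g c) := by
  rw [tendstoInMeasure_iff_dist] at h ⊢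
  intro e he
  obtain ⟨d, hd, H⟩ := Metric.continuousAt_iff.1 hg e he
  refine tendsto_of_tendsto_of_tendsto_of_le_of_le tendsto_const_nhds (h d hd)
    (fun _ => zero_le) (fun k => measure_mono fun ω hω => ?_)
  by_contra hcon
  exact absurd (H (not_le.1 hcon)) (not_lt.2 hω)

theorem tendstoInProb_pi {ι : Type*} [Fintype ι] {E : Type*} [PseudoMetricSpace E]
    {U : ℕ → Ω → ι → E} {c : ι → E}
    (h : ∀ i, TendstoInMeasure P (fun k ω => U k ω i) atTop (fun _ => c i)) :
    TendstoInMeasure P U atTop (fun _ => c) := by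
  simp_rw [tendstoInMeasure_iff_dist] at h ⊢
  intro e he
  have h2 : Tendsto (fun k => ∑ i, P {ω | e ≤ dist (U k ω i) (c i)}) atTop (𝓝 0) := by
    simpa using tendsto_finsetSum Finset.univ (fun i _ => h i e he)
  refine tendsto_of_tendsto_of_tendsto_of_le_of_le tendsto_const_nhds h2
    (fun _ => zero_le) (fun k => ?_)
  refine le_trans (measure_mono fun ω hω => ?_) (measure_iUnion_fintype_le P _)
  by_contra hcon
  simp only [Set.mem_iUnion, Set.mem_ofPred_eq, not_exists, not_le] at hcon
  exact absurd ((dist_pi_lt_iff he).2 hcon) (not_lt.2 hω)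

theorem tendstoInProb_prodMk {E F : Type*} [PseudoMetricSpace E] [PseudoMetricSpace F]
    {U : ℕ → Ω → E} {V : ℕ → Ω → F} {c : E} {d : F}
    (hU : TendstoInMeasure P U atTop (fun _ => c))
    (hV : TendstoInMeasure P V atTop (fun _ => d)) :
    TendstoInMeasure P (fun k ω => (U k ω, V k ω)) atTop (fun _ => (c, d)) := by
  simp_rw [tendstoInMeasure_iff_dist] at hU hV ⊢
  intro e he
  have h2 := (hU e he).add (hV e he)
  rw [add_zero] at h2
  refine tendsto_of_tendsto_of_tendsto_of_le_of_le tendsto_const_nhds h2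
    (fun _ => zero_le) (fun k => ?_)
  refine le_trans (measure_mono fun ω hω => ?_) (measure_union_le _ _)
  simpa [Prod.dist_eq] using hω

theorem tendstoInProb_add {U V : ℕ → Ω → ℝ} {c d : ℝ}
    (hU : TendstoInMeasure P U atTop (fun _ => c))
    (hV : TendstoInMeasure P V atTop (fun _ => d)) :
    TendstoInMeasure P (fun k ω => U k ω + V k ω) atTop (fun _ => c + d) := by
  have h := tendstoInProb_prodMk hU hV
  exact tendstoInProb_continuousAt h (g := fun x : ℝ × ℝ => x.1 + x.2)
    (by fun_prop : Continuous fun x : ℝ × ℝ => x.1 + x.2).continuousAt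

theorem tendstoInProb_mul {U V : ℕ → Ω → ℝ} {c d : ℝ}
    (hU : TendstoInMeasure P U atTop (fun _ => c))
    (hV : TendstoInMeasure P V atTop (fun _ => d)) :
    TendstoInMeasure P (fun k ω => U k ω * V k ω) atTop (fun _ => c * d) := by
  have h := tendstoInProb_prodMk hU hV
  exact tendstoInProb_continuousAt h (g := fun x : ℝ × ℝ => x.1 * x.2)
    (by fun_prop : Continuous fun x : ℝ × ℝ => x.1 * x.2).continuousAt

theorem tendstoInProb_const_mul {U : ℕ → Ω → ℝ} {c : ℝ} (a : ℝ)
    (hU : TendstoInMeasure P U atTop (fun _ => c)) :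
    TendstoInMeasure P (fun k ω => a * U k ω) atTop (fun _ => a * c) :=
  tendstoInProb_continuousAt (g := fun x : ℝ => a * x) hU (by fun_prop)

theorem tendstoInProb_sum {ι : Type*} (s : Finset ι) {U : ι → ℕ → Ω → ℝ} {c : ι → ℝ}
    (h : ∀ i ∈ s, TendstoInMeasure P (U i) atTop (fun _ => c i)) :
    TendstoInMeasure P (fun k ω => ∑ i ∈ s, U i k ω) atTop (fun _ => ∑ i ∈ s, c i) := by
  classical
  induction s using Finset.induction_on with
  | empty =>
    rw [tendstoInMeasure_iff_dist]
    intro e he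
    simp [not_le.2 he]
  | insert a s ha ih =>
    simp_rw [Finset.sum_insert ha]
    exact tendstoInProb_add (h a (by simp)) (ih fun i hi => h i (by simp [hi]))

theorem tendstoInProb_of_tendsto {E : Type*} [PseudoMetricSpace E] {u : ℕ → E} {c : E}
    (h : Tendsto u atTop (𝓝 c)) :
    TendstoInMeasure P (fun k _ => u k) atTop (fun _ => c) := by
  rw [tendstoInMeasure_iff_dist]
  intro e he
  refine tendsto_const_nhds.congr' ?_
  filter_upwards [(Metric.tendsto_nhds.1 h) e he] with k hk
  simp [not_le.2 hk]

/-- A squeeze principle: a sequence dominated in norm by one that tends to zero in probability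
on events whose probability tends to one also tends to zero. -/
theorem tendstoInProb_zero_of_le {E : Type*} [SeminormedAddCommGroup E]
    {U : ℕ → Ω → E} {V : ℕ → Ω → ℝ} {bad : ℕ → Set Ω}
    (hV : TendstoInMeasure P V atTop (fun _ => 0))
    (hbad : Tendsto (fun k => P (bad k)) atTop (𝓝 0))
    (h : ∀ᶠ k in atTop, ∀ᵐ ω ∂P, ω ∉ bad k → ‖U k ω‖ ≤ V k ω) :
    TendstoInMeasure P U atTop (fun _ => 0) := by
  simp_rw [tendstoInMeasure_iff_norm] at hV ⊢
  intro e he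
  have h2 := (hV e he).add hbad
  rw [add_zero] at h2
  refine tendsto_of_tendsto_of_tendsto_of_le_of_le' tendsto_const_nhds h2
    (Eventually.of_forall fun _ => zero_le) ?_
  filter_upwards [h] with k hk
  refine le_trans (measure_mono_ae ?_) (measure_union_le _ _)
  filter_upwards [hk] with ω hω hω2
  by_cases hb : ω ∈ bad k
  · exact Or.inr hb
  · refine Or.inl ?_
    change e ≤ ‖U k ω - 0‖ at hω2
    change e ≤ ‖V k ω - 0‖
    rw [sub_zero] at hω2 ⊢
    exact hω2.trans ((hω hb).trans (Real.le_norm_self _))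

theorem nonneg_of_tendstoInProb [NeZero P] {U : ℕ → Ω → ℝ} {c : ℝ}
    (h : TendstoInMeasure P U atTop (fun _ => c)) (h0 : ∀ k, ∀ᵐ ω ∂P, 0 ≤ U k ω) : 0 ≤ c := by
  obtain ⟨ns, -, hns⟩ := h.exists_seq_tendsto_ae
  obtain ⟨ω, h1, h2⟩ := (hns.and (ae_all_iff.2 h0)).exists
  exact ge_of_tendsto h1 (Eventually.of_forall fun i => h2 _)

theorem eq_of_tendstoInProb [NeZero P] {U : ℕ → Ω → ℝ} {c d : ℝ}
    (h : TendstoInMeasure P U atTop (fun _ => c))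
    (h' : TendstoInMeasure P U atTop (fun _ => d)) : c = d := by
  obtain ⟨ω, hω⟩ := (tendstoInMeasure_ae_unique h h').exists
  exact hω

/-- The event that a sequence converging in probability leaves a neighbourhood of its limit has
vanishing probability. -/
theorem tendsto_measure_notMem_of_tendstoInProb {E : Type*} [PseudoMetricSpace E]
    {U : ℕ → Ω → E} {c : E} (h : TendstoInMeasure P U atTop (fun _ => c)) {s : Set E}
    (hs : s ∈ 𝓝 c) : Tendsto (fun k => P {ω | U k ω ∉ s}) atTop (𝓝 0) := by
  rw [tendstoInMeasure_iff_dist] at h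
  obtain ⟨d, hd, H⟩ := Metric.mem_nhds_iff.1 hs
  refine tendsto_of_tendsto_of_tendsto_of_le_of_le tendsto_const_nhds (h d hd)
    (fun _ => zero_le) (fun k => measure_mono fun ω hω => ?_)
  by_contra hcon
  exact hω (H (Metric.mem_ball.2 (not_le.1 hcon)))

/-- Bounded convergence theorem for convergence in probability. -/
theorem tendsto_integral_of_tendstoInProb [IsProbabilityMeasure P] {U : ℕ → Ω → ℂ} {c : ℂ}
    {b : ℝ} (hm : ∀ k, AEStronglyMeasurable (U k) P) (hb : ∀ k, ∀ᵐ ω ∂P, ‖U k ω‖ ≤ b)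
    (h : TendstoInMeasure P U atTop (fun _ => c)) :
    Tendsto (fun k => ∫ ω, U k ω ∂P) atTop (𝓝 c) := by
  refine tendsto_of_subseq_tendsto fun ns hns => ?_
  obtain ⟨ms, -, hms⟩ := (h.comp hns).exists_seq_tendsto_ae'
  refine ⟨ms, ?_⟩
  have := tendsto_integral_of_dominated_convergence (F := fun i ω => U (ns (ms i)) ω)
    (f := fun _ => c) (μ := P) (fun _ => b) (fun i => hm _) (integrable_const b)
    (fun i => hb _) hms
  simpa using this

/-- Stochastic boundedness in use: a sequence converging in distribution, multiplied by one
tending to zero in probability, tends to zero in probability. -/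
theorem tendstoInProb_norm_mul_of_tendstoInDistribution [IsProbabilityMeasure P]
    {E : Type*} [NormedAddCommGroup E]
    [SecondCountableTopology E] [MeasurableSpace E] [BorelSpace E]
    {Ω' : Type*} [MeasurableSpace Ω'] {P' : Measure Ω'} [IsProbabilityMeasure P']
    {U : ℕ → Ω → E} {Z : Ω' → E} {V : ℕ → Ω → ℝ}
    (hU : TendstoInDistribution U atTop Z (fun _ => P) P')
    (hV : TendstoInMeasure P V atTop (fun _ => 0)) (hVm : ∀ k, AEMeasurable (V k) P) :
    TendstoInMeasure P (fun k ω => ‖U k ω‖ * V k ω) atTop (fun _ => 0) := by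
  have h := hU.continuous_comp_prodMk_of_tendstoInMeasure_const
    (g := fun x : E × ℝ => ‖x.1‖ * x.2) (by fun_prop) hV hVm
  simp only [mul_zero] at h
  rw [tendstoInMeasure_iff_norm]
  intro e he
  have hcl : IsClosed {x : ℝ | e ≤ ‖x‖} := isClosed_le continuous_const continuous_norm
  have h3 := ProbabilityMeasure.limsup_measure_closed_le_of_tendsto h.tendsto hcl
  have h4 : (P'.map (fun _ : Ω' => (0 : ℝ))) {x : ℝ | e ≤ ‖x‖} = 0 := by
    rw [Measure.map_apply measurable_const hcl.measurableSet]
    simp [not_le.2 he]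
  have h5 : ∀ k, (P.map (fun ω => ‖U k ω‖ * V k ω)) {x : ℝ | e ≤ ‖x‖}
      = P {ω | e ≤ ‖‖U k ω‖ * V k ω - 0‖} := by
    intro k
    rw [Measure.map_apply_of_aemeasurable (h.forall_aemeasurable k) hcl.measurableSet]
    simp
  have h6 : limsup (fun k => P {ω | e ≤ ‖‖U k ω‖ * V k ω - 0‖}) atTop ≤ 0 := by
    rw [← h4]
    simp_rw [← h5]
    exact h3
  exact tendsto_of_le_liminf_of_limsup_le zero_le h6

/-- Conditional Chebyshev: if `U k` and `η k` are independent and, with the first argument frozen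
at `U k ω`, the tails of `D k` under the law of `η k` obey a Chebyshev bound with variance proxy
`V k ω`, then `V k → 0` in probability forces `D k (U k) (η k) → 0` in probability. -/
theorem tendstoInProb_of_conditional_chebyshev [IsProbabilityMeasure P] {E F : ℕ → Type*}
    [∀ k, MeasurableSpace (E k)] [∀ k, MeasurableSpace (F k)]
    {U : ∀ k, Ω → E k} {η : ∀ k, Ω → F k} (hU : ∀ k, AEMeasurable (U k) P)
    (hη : ∀ k, AEMeasurable (η k) P) (hind : ∀ k, IndepFun (U k) (η k) P)
    {D : ∀ k, E k → F k → ℝ} (hD : ∀ k, Measurable (Function.uncurry (D k))) {V : ℕ → Ω → ℝ}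
    (hV : TendstoInMeasure P V atTop (fun _ => 0))
    (hb : ∀ k, ∀ᵐ ω ∂P, ∀ e : ℝ, 0 < e →
      (P.map (η k)) {y | e ≤ |D k (U k ω) y|} ≤ ENNReal.ofReal (V k ω / e ^ 2)) :
    TendstoInMeasure P (fun k ω => D k (U k ω) (η k ω)) atTop (fun _ => 0) := by
  rw [tendstoInMeasure_iff_norm] at hV ⊢
  intro e he
  have key : ∀ k (θ : ℝ), 0 < θ → P {ω | e ≤ ‖D k (U k ω) (η k ω) - 0‖} ≤
      P {ω | θ ≤ ‖V k ω - 0‖} + ENNReal.ofReal (θ / e ^ 2) := by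
    intro k θ hθ
    have : IsProbabilityMeasure (P.map (η k)) := Measure.isProbabilityMeasure_map (hη k)
    have hms : MeasurableSet {q : E k × F k | e ≤ |D k q.1 q.2|} :=
      measurableSet_le measurable_const (hD k).abs
    have h1 : P {ω | e ≤ ‖D k (U k ω) (η k ω) - 0‖} =
        (P.map (fun ω => (U k ω, η k ω))) {q : E k × F k | e ≤ |D k q.1 q.2|} := by
      rw [Measure.map_apply_of_aemeasurable ((hU k).prodMk (hη k)) hms]
      simp
    rw [h1, (indepFun_iff_map_prod_eq_prod_map_map (hU k) (hη k)).1 (hind k),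
      Measure.prod_apply hms,
      lintegral_map' (measurable_measure_prodMk_left hms).aemeasurable (hU k)]
    calc ∫⁻ ω, (P.map (η k)) (Prod.mk (U k ω) ⁻¹' {q : E k × F k | e ≤ |D k q.1 q.2|}) ∂P
        ≤ ∫⁻ ω, ({ω | θ ≤ ‖V k ω - 0‖}.indicator 1 ω + ENNReal.ofReal (θ / e ^ 2)) ∂P := by
          refine lintegral_mono_ae ?_
          filter_upwards [hb k] with ω hω
          by_cases hc : θ ≤ ‖V k ω - 0‖
          · rw [Set.indicator_of_mem (by exact hc)]
            exact le_trans prob_le_one le_self_add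
          · rw [Set.indicator_of_notMem (by exact hc), zero_add]
            refine (hω e he).trans (ENNReal.ofReal_le_ofReal ?_)
            rw [sub_zero, not_le] at hc
            have := (Real.le_norm_self (V k ω)).trans hc.le
            gcongr
      _ = ∫⁻ ω, {ω | θ ≤ ‖V k ω - 0‖}.indicator 1 ω ∂P + ENNReal.ofReal (θ / e ^ 2) := by
          rw [lintegral_add_right _ measurable_const]
          simp
      _ ≤ _ := by
          gcongr
          exact lintegral_indicator_one_le _
  rw [ENNReal.tendsto_nhds_zero]
  intro r hr
  obtain ⟨θ, hθ, hθr⟩ : ∃ θ : ℝ, 0 < θ ∧ ENNReal.ofReal (θ / e ^ 2) ≤ r / 2 := by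
    obtain ⟨q, hq0, hq⟩ := ENNReal.lt_iff_exists_nnreal_btwn.1 (ENNReal.half_pos hr.ne')
    refine ⟨q * e ^ 2, by have : 0 < q := by simpa using hq0
                          positivity, ?_⟩
    rw [mul_div_cancel_right₀ _ (by positivity), ENNReal.ofReal_coe_nnreal]
    exact hq.le
  filter_upwards [(ENNReal.tendsto_nhds_zero.1 (hV θ hθ)) (r / 2) (ENNReal.half_pos hr.ne')]
    with k hk
  calc _ ≤ _ := key k θ hθ
    _ ≤ r / 2 + r / 2 := add_le_add hk hθr
    _ = r := ENNReal.add_halves r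

end ConvergenceInProbability

/-! ### Gaussian vectors: linear combinations, linear and quadratic forms -/

section Gaussian

open scoped RealInnerProductSpace MatrixOrder

variable {Ω : Type*} [MeasurableSpace Ω] {P : Measure Ω}

theorem inner_eq_dotProduct {N : ℕ} (x y : EuclideanSpace ℝ (Fin N)) :
    ⟪x, y⟫ = x.ofLp ⬝ᵥ y.ofLp := by
  rw [PiLp.inner_apply, dotProduct]
  simp [mul_comm]

theorem dotProduct_mulVec_comm_of_isSymm {N : ℕ} {A : Matrix (Fin N) (Fin N) ℝ} (hA : A.IsSymm)
    (x y : Fin N → ℝ) : x ⬝ᵥ A.mulVec y = y ⬝ᵥ A.mulVec x := by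
  rw [Matrix.dotProduct_mulVec, ← Matrix.mulVec_transpose, hA.eq, dotProduct_comm]

/-- Two linear combinations, with orthogonal coefficient vectors, of i.i.d. centred Gaussian
vectors are independent Gaussian vectors. -/
theorem map_sum_smul_prod_eq {ι : Type*} [Fintype ι] [IsProbabilityMeasure P] {N : ℕ}
    {Sig : Matrix (Fin N) (Fin N) ℝ} (hSig : Sig.PosSemidef)
    {η : ι → Ω → EuclideanSpace ℝ (Fin N)}
    (hη : ∀ o, HasLaw (η o) (multivariateGaussian 0 Sig) P) (hind : iIndepFun η P)
    {a b : ι → ℝ} (hab : ∑ o, a o * b o = 0) :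
    P.map (fun ω => (∑ o, a o • η o ω, ∑ o, b o • η o ω)) =
      (multivariateGaussian 0 ((∑ o, a o ^ 2) • Sig)).prod
        (multivariateGaussian 0 ((∑ o, b o ^ 2) • Sig)) := by
  have hm : ∀ o, AEMeasurable (η o) P := fun o => (hη o).aemeasurable
  have hsq : ∀ c : ι → ℝ, 0 ≤ ∑ o, c o ^ 2 := fun c => Finset.sum_nonneg fun o _ => sq_nonneg _
  rw [← charFun_eq_prod_iff, AEMeasurable.map_map_of_aemeasurable (by fun_prop) (by fun_prop)]
  intro t
  rw [charFun_multivariateGaussian (hSig.smul (hsq a)),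
    charFun_multivariateGaussian (hSig.smul (hsq b)), charFun_apply,
    integral_map (by fun_prop) (by fun_prop)]
  have h1 : ∀ ω, Complex.exp (⟪((WithLp.toLp 2) ∘ fun ω =>
      (∑ o, a o • η o ω, ∑ o, b o • η o ω)) ω, t⟫ * Complex.I) =
      ∏ o, Complex.exp (⟪η o ω, a o • t.ofLp.1 + b o • t.ofLp.2⟫ * Complex.I) := by
    intro ω
    rw [← Complex.exp_sum, ← Finset.sum_mul]
    congr 2
    rw [WithLp.prod_inner_apply]
    simp only [Function.comp, sum_inner, inner_add_right, real_inner_smul_left,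
      real_inner_smul_right]
    push_cast
    rw [Finset.sum_add_distrib]
  have h2 := (iIndepFun_iff_map_fun_eq_pi_map hm).1 hind
  have h3 : ∫ ω, ∏ o, Complex.exp (⟪η o ω, a o • t.ofLp.1 + b o • t.ofLp.2⟫ * Complex.I) ∂P =
      ∏ o, charFun (multivariateGaussian 0 Sig) (a o • t.ofLp.1 + b o • t.ofLp.2) := by
    have h4 : ∫ ω, ∏ o, Complex.exp (⟪η o ω, a o • t.ofLp.1 + b o • t.ofLp.2⟫ * Complex.I) ∂P =
        ∫ y : ι → EuclideanSpace ℝ (Fin N), ∏ o, Complex.exp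
          (⟪y o, a o • t.ofLp.1 + b o • t.ofLp.2⟫ * Complex.I)
          ∂(P.map (fun ω o => η o ω)) := by
      rw [integral_map (by fun_prop)
        (Continuous.aestronglyMeasurable (by fun_prop))]
    rw [h4, h2]
    simp_rw [fun o => (hη o).map_eq]
    rw [integral_fintype_prod_eq_prod (f := fun o (y : EuclideanSpace ℝ (Fin N)) =>
      Complex.exp (⟪y, a o • t.ofLp.1 + b o • t.ofLp.2⟫ * Complex.I))]
    rfl
  simp_rw [h1]
  rw [h3]
  simp_rw [charFun_multivariateGaussian hSig]
  rw [← Complex.exp_sum, ← Complex.exp_add]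
  congr 1
  simp only [inner_zero_right, Complex.ofReal_zero, zero_mul, zero_sub]
  have hsym : Sig.IsSymm := by simpa using hSig.1
  have h5 : ∀ o, (a o • t.ofLp.1 + b o • t.ofLp.2).ofLp ⬝ᵥ
      Sig.mulVec (a o • t.ofLp.1 + b o • t.ofLp.2).ofLp =
      a o ^ 2 * (t.ofLp.1.ofLp ⬝ᵥ Sig.mulVec t.ofLp.1.ofLp) +
      b o ^ 2 * (t.ofLp.2.ofLp ⬝ᵥ Sig.mulVec t.ofLp.2.ofLp) +
      a o * b o * (2 * (t.ofLp.1.ofLp ⬝ᵥ Sig.mulVec t.ofLp.2.ofLp)) := by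
    intro o
    simp only [WithLp.ofLp_add, WithLp.ofLp_smul, Matrix.mulVec_add, Matrix.mulVec_smul,
      dotProduct_add, add_dotProduct, smul_dotProduct, dotProduct_smul, smul_eq_mul]
    rw [dotProduct_mulVec_comm_of_isSymm hsym t.ofLp.2.ofLp t.ofLp.1.ofLp]
    ring
  simp_rw [h5]
  rw [Finset.sum_neg_distrib, ← Finset.sum_div, ← Complex.ofReal_sum, Finset.sum_add_distrib,
    Finset.sum_add_distrib, ← Finset.sum_mul, ← Finset.sum_mul, ← Finset.sum_mul, hab]
  simp only [Matrix.smul_mulVec, dotProduct_smul, smul_eq_mul]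
  push_cast
  ring

theorem hasLaw_sum_smul {ι : Type*} [Fintype ι] [IsProbabilityMeasure P] {N : ℕ}
    {Sig : Matrix (Fin N) (Fin N) ℝ} (hSig : Sig.PosSemidef)
    {η : ι → Ω → EuclideanSpace ℝ (Fin N)}
    (hη : ∀ o, HasLaw (η o) (multivariateGaussian 0 Sig) P) (hind : iIndepFun η P)
    (a : ι → ℝ) :
    HasLaw (fun ω => ∑ o, a o • η o ω)
      (multivariateGaussian 0 ((∑ o, a o ^ 2) • Sig)) P := by
  have hm : ∀ o, AEMeasurable (η o) P := fun o => (hη o).aemeasurable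
  refine ⟨by fun_prop, ?_⟩
  have h := congrArg (Measure.map Prod.fst)
    (map_sum_smul_prod_eq hSig hη hind (a := a) (b := 0) (by simp))
  rw [AEMeasurable.map_map_of_aemeasurable (by fun_prop) (by fun_prop),
    Measure.map_fst_prod] at h
  simpa [Function.comp_def] using h

/-- Chebyshev's inequality for a linear form of a centred Gaussian vector. -/
theorem multivariateGaussian_linear_tail {N : ℕ} {Sig : Matrix (Fin N) (Fin N) ℝ}
    (hSig : Sig.PosSemidef) (a : Fin N → ℝ) {e : ℝ} (he : 0 < e) :
    multivariateGaussian 0 Sig {w | e ≤ |a ⬝ᵥ w.ofLp|} ≤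
      ENNReal.ofReal ((a ⬝ᵥ Sig.mulVec a) / e ^ 2) := by
  set x : EuclideanSpace ℝ (Fin N) := WithLp.toLp 2 a
  have hL : MemLp (fun w => ⟪x, w⟫) 2 (multivariateGaussian 0 Sig) :=
    IsGaussian.memLp_two_id.const_inner x
  have h0 : ∫ w, ⟪x, w⟫ ∂(multivariateGaussian 0 Sig) = 0 := by
    rw [integral_inner IsGaussian.integrable_fun_id]
    simp
  have hv : Var[fun w => ⟪x, w⟫; multivariateGaussian 0 Sig] = a ⬝ᵥ Sig.mulVec a := by
    rw [← covarianceBilin_self IsGaussian.memLp_two_id, covarianceBilin_multivariateGaussian hSig]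
  have := meas_ge_le_variance_div_sq hL he
  rw [h0, hv] at this
  simpa [inner_eq_dotProduct, x] using this

/-- The law of a quadratic form of a centred Gaussian vector is that of a weighted sum of squares
of independent standard Gaussian variables; the weights are the eigenvalues of
`Σ^{1/2} Q Σ^{1/2}`. -/
theorem exists_map_quadratic_eq {N : ℕ} {Sig Q : Matrix (Fin N) (Fin N) ℝ}
    (hSig : Sig.PosSemidef) (hQ : Q.IsHermitian) :
    ∃ l : Fin N → ℝ, ∑ i, l i = (Q * Sig).trace ∧ ∑ i, l i ^ 2 = (Q * Sig * Q * Sig).trace ∧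
      (multivariateGaussian 0 Sig).map (fun w => w.ofLp ⬝ᵥ Q.mulVec w.ofLp) =
      (Measure.pi fun _ : Fin N => gaussianReal 0 1).map (fun x => ∑ i, l i * x i ^ 2) := by
  set H := CFC.sqrt Sig with hH
  have hHH : H * H = Sig := CFC.sqrt_mul_sqrt_self _ hSig.nonneg
  have hHs : H.IsHermitian := (CFC.sqrt_nonneg Sig).isSelfAdjoint
  have hR : (H * Q * H).IsHermitian := by
    have := Matrix.isHermitian_conjTranspose_mul_mul H hQ
    rwa [hHs.eq] at this
  have hHt : H.transpose = H := by simpa using hHs.eq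
  refine ⟨hR.eigenvalues, ?_, ?_, ?_⟩
  · have h := hR.trace_eq_sum_eigenvalues
    simp only [RCLike.ofReal_real_eq_id, id] at h
    rw [← h, ← hHH, Matrix.trace_mul_comm, ← mul_assoc, Matrix.trace_mul_comm]
  · have h1 : (H * Q * H * (H * Q * H)).trace = ∑ i, hR.eigenvalues i ^ 2 := by
      conv_lhs => rw [hR.spectral_theorem]
      rw [← map_mul, Unitary.conjStarAlgAut_apply, Matrix.trace_mul_cycle]
      simp [Matrix.trace, Matrix.diagonal_mul_diagonal, pow_two]
    rw [← h1, ← hHH, show H * Q * H * (H * Q * H) = H * (Q * H * H * Q * H) by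
      simp only [mul_assoc], Matrix.trace_mul_comm]
    simp only [mul_assoc]
  · rw [multivariateGaussian,
      stdGaussian_eq_map_pi_orthonormalBasis hR.eigenvectorBasis,
      Measure.map_map (by fun_prop) (by fun_prop), Measure.map_map (by fun_prop) (by fun_prop)]
    congr 1
    ext x
    simp only [Function.comp, zero_add]
    set y : EuclideanSpace ℝ (Fin N) := ∑ i, x i • hR.eigenvectorBasis i with hy
    have hlp : ((Matrix.toEuclideanCLM (𝕜 := ℝ) H) y).ofLp = H.mulVec y.ofLp := by
      simp
    have h1 : H.mulVec y.ofLp ⬝ᵥ Q.mulVec (H.mulVec y.ofLp) =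
        y.ofLp ⬝ᵥ (H * Q * H).mulVec y.ofLp := by
      rw [dotProduct_comm, Matrix.dotProduct_mulVec, ← Matrix.mulVec_transpose, hHt,
        dotProduct_comm, Matrix.mulVec_mulVec, Matrix.mulVec_mulVec, mul_assoc]
    have h2 : WithLp.toLp 2 ((H * Q * H).mulVec y.ofLp) =
        ∑ i, (hR.eigenvalues i * x i) • hR.eigenvectorBasis i := by
      ext j
      simp only [hy, WithLp.ofLp_sum, WithLp.ofLp_smul, Matrix.mulVec_sum, Matrix.mulVec_smul,
        hR.mulVec_eigenvectorBasis, Finset.sum_apply, Pi.smul_apply, smul_eq_mul]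
      exact Finset.sum_congr rfl fun i _ => by ring
    have h3 := inner_eq_dotProduct y (WithLp.toLp 2 ((H * Q * H).mulVec y.ofLp))
    rw [hlp, h1, ← h3, h2, hy, hR.eigenvectorBasis.orthonormal.inner_sum]
    simp only [conj_trivial]
    exact Finset.sum_congr rfl fun i _ => by ring

/-- The Chebyshev constant for Gaussian quadratic forms: the variance of the square of a standard
Gaussian variable. -/
noncomputable def sqVar : ℝ := Var[fun x => x ^ 2; gaussianReal 0 1]

/-- Chebyshev's inequality for a quadratic form of a centred Gaussian vector. -/
theorem multivariateGaussian_quadratic_tail {N : ℕ} {Sig Q : Matrix (Fin N) (Fin N) ℝ}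
    (hSig : Sig.PosSemidef) (hQ : Q.IsHermitian) {e : ℝ} (he : 0 < e) :
    multivariateGaussian 0 Sig {w | e ≤ |w.ofLp ⬝ᵥ Q.mulVec w.ofLp - (Q * Sig).trace|} ≤
      ENNReal.ofReal (sqVar * (Q * Sig * Q * Sig).trace / e ^ 2) := by
  obtain ⟨l, hl1, hl2, hl⟩ := exists_map_quadratic_eq hSig hQ
  have hg : MemLp (fun x : ℝ => x ^ 2) 2 (gaussianReal 0 1) := by
    have := (memLp_id_gaussianReal' (μ := 0) (v := 1) 4 (by simp))
    rw [memLp_two_iff_integrable_sq (by fun_prop)]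
    have h2 := this.integrable_norm_pow (by simp)
    simp only [id, Real.norm_eq_abs] at h2
    refine h2.congr (ae_of_all _ fun x => ?_)
    change |x| ^ 4 = _
    rw [← abs_pow, abs_of_nonneg (by positivity)]
    ring
  have hm1 : ∫ x : ℝ, x ^ 2 ∂(gaussianReal 0 1) = 1 := by
    have h := variance_id_gaussianReal (μ := 0) (v := 1)
    rw [variance_eq_integral (by fun_prop)] at h
    simpa using h
  set π := Measure.pi fun _ : Fin N => gaussianReal 0 1 with hπ
  have hmem : ∀ i : Fin N, MemLp (fun x : Fin N → ℝ => l i * x i ^ 2) 2 π := fun i =>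
    (hg.const_mul (l i)).comp_measurePreserving (measurePreserving_eval _ i)
  have hL2 : MemLp (fun x : Fin N → ℝ => ∑ i, l i * x i ^ 2) 2 π :=
    memLp_finsetSum _ fun i _ => hmem i
  have hmean : ∫ x, ∑ i, l i * x i ^ 2 ∂π = (Q * Sig).trace := by
    rw [integral_finsetSum _ fun i _ => (hmem i).integrable (by simp), ← hl1]
    refine Finset.sum_congr rfl fun i _ => ?_
    have h := integral_comp_eval (μ := fun _ : Fin N => gaussianReal 0 1) (i := i)
      (f := fun y : ℝ => y ^ 2) (by fun_prop)
    rw [integral_const_mul, h, hm1, mul_one]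
  have hvar : Var[fun x : Fin N → ℝ => ∑ i, l i * x i ^ 2; π] =
      sqVar * (Q * Sig * Q * Sig).trace := by
    have h := variance_sum_pi (μ := fun _ : Fin N => gaussianReal 0 1)
      (X := fun i (y : ℝ) => l i * y ^ 2) (fun i => hg.const_mul (l i))
    have h2 : (∑ i, fun ω : Fin N → ℝ => l i * ω i ^ 2) = fun ω => ∑ i, l i * ω i ^ 2 := by
      ext; simp
    rw [h2] at h
    rw [h, ← hl2, Finset.mul_sum]
    refine Finset.sum_congr rfl fun i _ => ?_
    rw [variance_const_mul, sqVar]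
    ring
  have hms : MeasurableSet {y : ℝ | e ≤ |y - (Q * Sig).trace|} :=
    measurableSet_le measurable_const (by fun_prop)
  have hcm : Measurable fun w : EuclideanSpace ℝ (Fin N) => w.ofLp ⬝ᵥ Q.mulVec w.ofLp := by
    simp only [dotProduct, Matrix.mulVec]
    fun_prop
  have := meas_ge_le_variance_div_sq hL2 he
  rw [hmean, hvar] at this
  refine le_trans (le_of_eq ?_) this
  have h3 := congrArg (fun m => m {y : ℝ | e ≤ |y - (Q * Sig).trace|}) hl
  simp only at h3
  rw [Measure.map_apply hcm hms, Measure.map_apply (by fun_prop) hms] at h3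
  exact h3

end Gaussian

/-! ### The deterministic minimization problem -/

section Deterministic

open scoped RealInnerProductSpace MatrixOrder

variable {V : Type*} [NormedAddCommGroup V] [InnerProductSpace ℝ V]

/-- The total least squares objective, recentred at the true parameter `β`: up to an additive
constant and a positive factor, it is this function of the error `d`. -/
noncomputable def recentred (C : V →L[ℝ] V) (h β d : V) : ℝ :=
  (⟪d, C d⟫ - 2 * ⟪h, d⟫) / (1 + ‖β + d‖ ^ 2)

variable {C : V →L[ℝ] V} {h β : V} {c : ℝ}

theorem recentred_zero : recentred C h β 0 = 0 := by simp [recentred]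

theorem one_add_norm_sq_pos {E : Type*} [SeminormedAddCommGroup E] (x : E) :
    0 < 1 + ‖x‖ ^ 2 := by
  positivity

theorem le_recentred_numerator (hc : ∀ d, c * ‖d‖ ^ 2 ≤ ⟪d, C d⟫) (d : V) :
    c * ‖d‖ ^ 2 - 2 * (‖h‖ * ‖d‖) ≤ ⟪d, C d⟫ - 2 * ⟪h, d⟫ := by
  have := hc d
  have := real_inner_le_norm h d
  linarith

theorem norm_le_of_isMin_recentred (hc0 : 0 < c) (hc : ∀ d, c * ‖d‖ ^ 2 ≤ ⟪d, C d⟫) {d : V}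
    (hd : recentred C h β d ≤ 0) : ‖d‖ ≤ 2 * ‖h‖ / c := by
  have h1 : ⟪d, C d⟫ - 2 * ⟪h, d⟫ ≤ 0 := by
    by_contra hcon
    exact absurd hd (not_le.2 (div_pos (not_le.1 hcon) (one_add_norm_sq_pos _)))
  have h2 := (le_recentred_numerator (h := h) hc d).trans h1
  rw [le_div_iff₀ hc0]
  rcases (norm_nonneg d).eq_or_lt with h3 | h3
  · rw [← h3, zero_mul]; positivity
  · by_contra hcon
    nlinarith [mul_pos h3 (sub_pos.2 (not_le.1 hcon))]

theorem exists_isMin_recentred [FiniteDimensional ℝ V] (hc0 : 0 < c)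
    (hc : ∀ d, c * ‖d‖ ^ 2 ≤ ⟪d, C d⟫) :
    ∃ d, ∀ d', recentred C h β d ≤ recentred C h β d' := by
  have hcont : Continuous (recentred C h β) := by
    unfold recentred
    exact Continuous.div (by fun_prop) (by fun_prop) fun x => (one_add_norm_sq_pos _).ne'
  have hr : 0 ≤ 2 * ‖h‖ / c := by positivity
  -- Outside this ball the objective exceeds its value `0` at the origin.
  obtain ⟨d, -, hd⟩ := (isCompact_closedBall (0 : V) (2 * ‖h‖ / c)).exists_isMinOn
    ⟨0, by simpa using hr⟩ hcont.continuousOn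
  refine ⟨d, fun d' => ?_⟩
  by_cases hd' : d' ∈ Metric.closedBall (0 : V) (2 * ‖h‖ / c)
  · exact hd hd'
  · have h0 : recentred C h β d ≤ recentred C h β 0 := hd (by simpa using hr)
    rw [recentred_zero] at h0
    by_contra hcon
    exact hd' (by
      simpa using norm_le_of_isMin_recentred hc0 hc ((not_le.1 hcon).le.trans h0))

/-- The second-order expansion of the objective around a point `d`, after clearing the
denominator. -/
theorem recentred_expansion (hsym : ∀ x y, ⟪C x, y⟫ = ⟪x, C y⟫) (d e : V) (μ : ℝ)
    (hμ : recentred C h β d = μ) :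
    (recentred C h β (d + e) - μ) * (1 + ‖β + (d + e)‖ ^ 2) =
      ⟪e, C e⟫ - μ * ‖e‖ ^ 2 + 2 * ⟪e, C d - h - μ • (β + d)⟫ := by
  have h1 : ⟪d, C d⟫ - 2 * ⟪h, d⟫ = μ * (1 + ‖β + d‖ ^ 2) := by
    rw [← hμ, recentred, div_mul_cancel₀ _ (one_add_norm_sq_pos _).ne']
  have h2 : ‖β + (d + e)‖ ^ 2 = ‖β + d‖ ^ 2 + 2 * ⟪e, β + d⟫ + ‖e‖ ^ 2 := by
    rw [← add_assoc, norm_add_sq_real, real_inner_comm]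
  have h3 : ⟪d, C e⟫ = ⟪e, C d⟫ := by rw [← hsym, real_inner_comm]
  rw [sub_mul, recentred, div_mul_cancel₀ _ (one_add_norm_sq_pos _).ne', h2]
  simp only [map_add, inner_add_left, inner_add_right, inner_sub_right, real_inner_smul_right, h3,
    real_inner_comm e h] at h1 ⊢
  linarith

/-- The first-order condition at a minimizer. -/
theorem firstOrder_of_isMin_recentred (hsym : ∀ x y, ⟪C x, y⟫ = ⟪x, C y⟫) {d : V}
    (hd : ∀ d', recentred C h β d ≤ recentred C h β d') :
    C d = h + recentred C h β d • (β + d) := by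
  set μ := recentred C h β d with hμ
  set g := C d - h - μ • (β + d) with hg
  have key : ∀ e, 0 ≤ ⟪e, C e⟫ - μ * ‖e‖ ^ 2 + 2 * ⟪e, g⟫ := by
    intro e
    rw [← recentred_expansion hsym d e μ rfl]
    exact mul_nonneg (sub_nonneg.2 (hd _)) (one_add_norm_sq_pos _).le
  -- Along the line spanned by `g` this is a nonnegative quadratic without constant term, so its
  -- linear coefficient `2 ‖g‖²` vanishes.
  have hline : ∀ t : ℝ, 0 ≤ (⟪g, C g⟫ - μ * ‖g‖ ^ 2) * (t * t) + (2 * ‖g‖ ^ 2) * t + 0 := by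
    intro t
    have := key (t • g)
    simp only [map_smul, real_inner_smul_left, real_inner_smul_right, norm_smul, mul_pow,
      Real.norm_eq_abs, sq_abs, real_inner_self_eq_norm_sq] at this
    linarith
  have hdisc := discrim_le_zero hline
  have hg0 : ‖g‖ ^ 2 = 0 := by
    simp only [discrim] at hdisc
    nlinarith [sq_nonneg (‖g‖ ^ 2)]
  have : g = 0 := by simpa using hg0
  rw [hg, sub_sub, sub_eq_zero] at this
  exact this

/-- The minimal value is nonpositive and of second order in `h`. -/
theorem abs_recentred_le_of_isMin (hc0 : 0 < c) (hc : ∀ d, c * ‖d‖ ^ 2 ≤ ⟪d, C d⟫) {d : V}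
    (hd : recentred C h β d ≤ 0) : |recentred C h β d| ≤ ‖h‖ ^ 2 / c := by
  rw [abs_of_nonpos hd, recentred, ← neg_div, div_le_iff₀ (one_add_norm_sq_pos _)]
  have h1 := le_recentred_numerator (h := h) hc d
  have h2 : -(‖h‖ ^ 2 / c) ≤ c * ‖d‖ ^ 2 - 2 * (‖h‖ * ‖d‖) := by
    have : c * ‖d‖ ^ 2 - 2 * (‖h‖ * ‖d‖) + ‖h‖ ^ 2 / c = (c * ‖d‖ - ‖h‖) ^ 2 / c := by
      field_simp
      ring
    have : 0 ≤ (c * ‖d‖ - ‖h‖) ^ 2 / c := by positivity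
    linarith
  have h3 : 0 ≤ ‖h‖ ^ 2 / c * ‖β + d‖ ^ 2 := by positivity
  linarith

theorem existsUnique_isMin_recentred [FiniteDimensional ℝ V]
    (hsym : ∀ x y, ⟪C x, y⟫ = ⟪x, C y⟫) (hc0 : 0 < c) (hc : ∀ d, c * ‖d‖ ^ 2 ≤ ⟪d, C d⟫) :
    ∃! d, ∀ d', recentred C h β d ≤ recentred C h β d' := by
  obtain ⟨d, hd⟩ := exists_isMin_recentred (h := h) (β := β) hc0 hc
  refine ⟨d, hd, fun d' hd' => ?_⟩
  have hle : recentred C h β d ≤ 0 := (hd 0).trans_eq recentred_zero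
  have heq : recentred C h β d' = recentred C h β d := le_antisymm (hd' d) (hd d')
  have h1 := recentred_expansion (h := h) (β := β) hsym d (d' - d) _ rfl
  rw [firstOrder_of_isMin_recentred hsym hd] at h1
  simp only [add_sub_cancel, heq, sub_self, zero_mul, add_sub_cancel_left, inner_zero_right,
    mul_zero, add_zero] at h1
  have h2 := hc (d' - d)
  have h3 : c * ‖d' - d‖ ^ 2 ≤ 0 := by
    nlinarith [mul_nonneg (neg_nonneg.2 hle) (sq_nonneg ‖d' - d‖)]
  have h4 : ‖d' - d‖ ^ 2 = 0 :=
    le_antisymm (by by_contra hcon; nlinarith [mul_pos hc0 (not_le.1 hcon)]) (sq_nonneg _)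
  exact sub_eq_zero.1 (by simpa using h4)

/-- Linearization: the minimizer solves `D d = h` up to an error quadratic in `h` and one bilinear
in `h` and `D - C`. -/
theorem norm_apply_sub_le_of_isMin (D : V →L[ℝ] V) (hsym : ∀ x y, ⟪C x, y⟫ = ⟪x, C y⟫)
    (hc0 : 0 < c) (hc : ∀ d, c * ‖d‖ ^ 2 ≤ ⟪d, C d⟫) {d : V}
    (hd : ∀ d', recentred C h β d ≤ recentred C h β d') :
    ‖D d - h‖ ≤ ‖h‖ * (‖h‖ / c * (‖β‖ + 2 * ‖h‖ / c) + ‖D - C‖ * (2 / c)) := by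
  have hle : recentred C h β d ≤ 0 := (hd 0).trans_eq recentred_zero
  have h1 := norm_le_of_isMin_recentred hc0 hc hle
  have h2 := abs_recentred_le_of_isMin hc0 hc hle
  have h3 : D d - h = recentred C h β d • (β + d) + (D - C) d := by
    rw [_root_.sub_apply, firstOrder_of_isMin_recentred hsym hd]
    abel
  calc ‖D d - h‖ ≤ |recentred C h β d| * ‖β + d‖ + ‖D - C‖ * ‖d‖ := by
        rw [h3]
        refine (norm_add_le _ _).trans (add_le_add ?_ ((D - C).le_opNorm d))
        rw [norm_smul, Real.norm_eq_abs]
    _ ≤ ‖h‖ ^ 2 / c * (‖β‖ + 2 * ‖h‖ / c) + ‖D - C‖ * (2 * ‖h‖ / c) := by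
        gcongr
        exact (norm_add_le _ _).trans (by gcongr)
    _ = _ := by ring

end Deterministic

section Objective

open scoped MatrixOrder RealInnerProductSpace

variable {N p : ℕ}

theorem invSqrt_mul_invSqrt {S : Matrix (Fin N) (Fin N) ℝ} (hS : S.PosDef) :
    invSqrt S * invSqrt S = S⁻¹ := by
  rw [invSqrt, ← Matrix.mul_inv_rev, CFC.sqrt_mul_sqrt_self _ hS.posSemidef.nonneg]

theorem invSqrt_isHermitian (S : Matrix (Fin N) (Fin N) ℝ) : (invSqrt S).IsHermitian := by
  have h : (CFC.sqrt S).IsHermitian := (CFC.sqrt_nonneg S).isSelfAdjoint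
  exact h.inv

theorem objective_eq {S : Matrix (Fin N) (Fin N) ℝ} (hS : S.PosDef)
    (Xt : Matrix (Fin N) (Fin p) ℝ) (Y : EuclideanSpace ℝ (Fin N))
    (b : EuclideanSpace ℝ (Fin p)) :
    objective S Xt Y b = ((Y.ofLp - Xt.mulVec b.ofLp) ⬝ᵥ
      S⁻¹.mulVec (Y.ofLp - Xt.mulVec b.ofLp)) / (1 + ‖b‖ ^ 2) := by
  rw [objective, ← inner_eq_dotProduct b b, real_inner_self_eq_norm_sq,
    ← real_inner_self_eq_norm_sq (WithLp.toLp 2 _), inner_eq_dotProduct,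
    ← invSqrt_mul_invSqrt hS, ← Matrix.mulVec_mulVec]
  congr 1
  have ht : (invSqrt S).transpose = invSqrt S := by simpa using (invSqrt_isHermitian S).eq
  simp only
  rw [Matrix.dotProduct_mulVec _ (invSqrt S) (Matrix.mulVec _ _), ← Matrix.mulVec_transpose, ht]

/-- The whitened residual sum of squares, per observation and divided by `1 + βᵀβ`. -/
noncomputable def lamHat (B : Matrix (Fin N) (Fin N) ℝ) (r : EuclideanSpace ℝ (Fin N))
    (β : EuclideanSpace ℝ (Fin p)) : ℝ :=
  (N : ℝ)⁻¹ * (r.ofLp ⬝ᵥ B.mulVec r.ofLp) / (1 + ‖β‖ ^ 2)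

/-- The curvature matrix of the recentred objective. -/
noncomputable def curvature (B : Matrix (Fin N) (Fin N) ℝ) (Xt : Matrix (Fin N) (Fin p) ℝ)
    (r : EuclideanSpace ℝ (Fin N)) (β : EuclideanSpace ℝ (Fin p)) : Matrix (Fin p) (Fin p) ℝ :=
  (N : ℝ)⁻¹ • (Xt.transpose * B * Xt) - lamHat B r β • 1

/-- The score vector of the recentred objective. -/
noncomputable def score (B : Matrix (Fin N) (Fin N) ℝ) (Xt : Matrix (Fin N) (Fin p) ℝ)
    (r : EuclideanSpace ℝ (Fin N)) (β : EuclideanSpace ℝ (Fin p)) : EuclideanSpace ℝ (Fin p) :=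
  WithLp.toLp 2 ((N : ℝ)⁻¹ • (Xt.transpose * B).mulVec r.ofLp) + lamHat B r β • β

theorem objective_eq_recentred (hN : 0 < N) {S : Matrix (Fin N) (Fin N) ℝ} (hS : S.PosDef)
    (Xt : Matrix (Fin N) (Fin p) ℝ) (Y r : EuclideanSpace ℝ (Fin N))
    (β d : EuclideanSpace ℝ (Fin p)) (hr : r.ofLp = Y.ofLp - Xt.mulVec β.ofLp) :
    objective S Xt Y (β + d) = N * (lamHat S⁻¹ r β +
      recentred (Matrix.toEuclideanCLM (𝕜 := ℝ) (curvature S⁻¹ Xt r β))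
        (score S⁻¹ Xt r β) β d) := by
  have hN' : (N : ℝ) ≠ 0 := by positivity
  have hB : S⁻¹.IsSymm := by simpa using hS.inv.1
  have h1 : Y.ofLp - Xt.mulVec (β + d).ofLp = r.ofLp - Xt.mulVec d.ofLp := by
    rw [hr, WithLp.ofLp_add, Matrix.mulVec_add, sub_sub]
  have hpos := one_add_norm_sq_pos (β + d)
  have hposβ := one_add_norm_sq_pos β
  have hD : ‖β + d‖ ^ 2 = ‖β‖ ^ 2 + 2 * (β.ofLp ⬝ᵥ d.ofLp) + ‖d‖ ^ 2 := by
    rw [norm_add_sq_real, inner_eq_dotProduct]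
  have e1 : (Xt.mulVec d.ofLp) ⬝ᵥ S⁻¹.mulVec (Xt.mulVec d.ofLp) =
      d.ofLp ⬝ᵥ (Xt.transpose * S⁻¹ * Xt).mulVec d.ofLp := by
    rw [← Matrix.mulVec_mulVec, ← Matrix.mulVec_mulVec, Matrix.dotProduct_mulVec d.ofLp,
      ← Matrix.mulVec_transpose, Matrix.transpose_transpose]
  have e2 : (Xt.mulVec d.ofLp) ⬝ᵥ S⁻¹.mulVec r.ofLp =
      (Xt.transpose * S⁻¹).mulVec r.ofLp ⬝ᵥ d.ofLp := by
    rw [← Matrix.mulVec_mulVec, dotProduct_comm _ d.ofLp, Matrix.dotProduct_mulVec d.ofLp,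
      ← Matrix.mulVec_transpose, Matrix.transpose_transpose]
  rw [objective_eq hS, h1, recentred, div_eq_iff hpos.ne', mul_assoc, add_mul,
    div_mul_cancel₀ _ hpos.ne']
  simp only [inner_eq_dotProduct, score, curvature, Matrix.ofLp_toEuclideanCLM, WithLp.ofLp_add,
    WithLp.ofLp_smul, Matrix.sub_mulVec, Matrix.smul_mulVec, dotProduct_sub, sub_dotProduct,
    Matrix.mulVec_sub, dotProduct_smul, smul_dotProduct, add_dotProduct, Matrix.one_mulVec,
    smul_eq_mul]
  rw [dotProduct_mulVec_comm_of_isSymm hB r.ofLp (Xt.mulVec d.ofLp), e1, e2, hD,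
    ← inner_eq_dotProduct d d, real_inner_self_eq_norm_sq]
  have hl : r.ofLp ⬝ᵥ S⁻¹.mulVec r.ofLp = N * lamHat S⁻¹ r β * (1 + ‖β‖ ^ 2) := by
    rw [lamHat]
    field_simp
  rw [hl]
  field_simp
  ring

end Objective

/-! ### Laws of large numbers for forms with a random kernel -/

section MatrixMeasurable

/-- Matrices carry the product measurable structure of their entries. -/
@[reducible] def matrixMeasurableSpace (m n : Type*) : MeasurableSpace (Matrix m n ℝ) :=
  inferInstanceAs (MeasurableSpace (m → n → ℝ))

attribute [local instance] matrixMeasurableSpace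

theorem matrix_borelSpace (m n : Type*) [Fintype m] [Fintype n] :
    BorelSpace (Matrix m n ℝ) :=
  inferInstanceAs (BorelSpace (m → n → ℝ))

theorem matrix_secondCountable (m n : Type*) [Fintype m] [Fintype n] :
    SecondCountableTopology (Matrix m n ℝ) :=
  inferInstanceAs (SecondCountableTopology (m → n → ℝ))

attribute [local instance] matrix_borelSpace matrix_secondCountable

variable {Ω : Type*} [MeasurableSpace Ω] {P : Measure Ω} [IsProbabilityMeasure P]

open scoped MatrixOrder RealInnerProductSpace

/-- Quadratic forms of a Gaussian vector, with an independent random kernel, concentrate around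
their conditional mean. -/
theorem tendstoInProb_quadratic {N : ℕ → ℕ} {Sig : ∀ k, Matrix (Fin (N k)) (Fin (N k)) ℝ}
    (hSig : ∀ k, (Sig k).PosSemidef) {Q : ∀ k, Ω → Matrix (Fin (N k)) (Fin (N k)) ℝ}
    {w : ∀ k, Ω → EuclideanSpace ℝ (Fin (N k))} {c τ : ℝ} (hc : 0 ≤ c)
    (hQm : ∀ k, AEMeasurable (Q k) P)
    (hw : ∀ k, HasLaw (w k) (multivariateGaussian 0 (c • Sig k)) P)
    (hind : ∀ k, IndepFun (Q k) (w k) P) (hQ : ∀ k, ∀ᵐ ω ∂P, (Q k ω).IsHermitian)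
    (h1 : TendstoInMeasure P (fun k ω => (N k : ℝ)⁻¹ * (Q k ω * Sig k).trace) atTop (fun _ => τ))
    (h2 : TendstoInMeasure P
      (fun k ω => ((N k : ℝ) ^ 2)⁻¹ * (Q k ω * Sig k * Q k ω * Sig k).trace) atTop (fun _ => 0)) :
    TendstoInMeasure P
      (fun k ω => (N k : ℝ)⁻¹ * ((w k ω).ofLp ⬝ᵥ (Q k ω).mulVec (w k ω).ofLp)) atTop
      (fun _ => c * τ) := by
  have hdev := tendstoInProb_of_conditional_chebyshev (P := P) (U := Q) (η := w) hQm
    (fun k => (hw k).aemeasurable) hind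
    (D := fun k A y => (N k : ℝ)⁻¹ * (y.ofLp ⬝ᵥ A.mulVec y.ofLp - (A * (c • Sig k)).trace))
    (fun k => Continuous.measurable (by unfold Function.uncurry; fun_prop))
    (V := fun k ω => (sqVar * c ^ 2) *
      (((N k : ℝ) ^ 2)⁻¹ * (Q k ω * Sig k * Q k ω * Sig k).trace))
    (by simpa using tendstoInProb_const_mul (sqVar * c ^ 2) h2) ?_
  · have := tendstoInProb_add hdev (tendstoInProb_const_mul c h1)
    rw [zero_add] at this
    refine this.congr_left fun k => ae_of_all _ fun ω => ?_
    simp only [Matrix.mul_smul, Matrix.trace_smul, smul_eq_mul]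
    ring
  · intro k
    filter_upwards [hQ k] with ω hω e he
    rw [(hw k).map_eq]
    rcases Nat.eq_zero_or_pos (N k) with h0 | h0
    -- For `N = 0` the deviation vanishes identically because `0⁻¹ = 0`.
    · have : {y : EuclideanSpace ℝ (Fin (N k)) | e ≤ |(N k : ℝ)⁻¹ *
          (y.ofLp ⬝ᵥ (Q k ω).mulVec y.ofLp - (Q k ω * (c • Sig k)).trace)|} = ∅ := by
        ext y
        simp [h0, not_le.2 he]
      rw [this]
      simp
    · have hN : (0 : ℝ) < N k := by exact_mod_cast h0
      have := multivariateGaussian_quadratic_tail ((hSig k).smul hc) hω (e := N k * e)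
        (by positivity)
      refine le_trans (measure_mono fun y hy => ?_) (this.trans_eq ?_)
      · have hy' : e ≤ |(N k : ℝ)⁻¹ *
          (y.ofLp ⬝ᵥ (Q k ω).mulVec y.ofLp - (Q k ω * (c • Sig k)).trace)| := hy
        rw [abs_mul, abs_of_pos (inv_pos.2 hN), inv_mul_eq_div, le_div_iff₀ hN] at hy'
        exact (mul_comm _ _).trans_le hy'
      · congr 1
        simp only [Matrix.mul_smul, Matrix.smul_mul, Matrix.trace_smul, smul_eq_mul]
        field_simp

/-- Linear forms of a Gaussian vector with independent random coefficients of vanishing conditional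
variance tend to zero in probability. -/
theorem tendstoInProb_linear {N : ℕ → ℕ} {Sig : ∀ k, Matrix (Fin (N k)) (Fin (N k)) ℝ}
    (hSig : ∀ k, (Sig k).PosSemidef) {u : ∀ k, Ω → Fin (N k) → ℝ}
    {w : ∀ k, Ω → EuclideanSpace ℝ (Fin (N k))} {c : ℝ} (hc : 0 ≤ c)
    (hum : ∀ k, AEMeasurable (u k) P)
    (hw : ∀ k, HasLaw (w k) (multivariateGaussian 0 (c • Sig k)) P)
    (hind : ∀ k, IndepFun (u k) (w k) P)
    (h : TendstoInMeasure P (fun k ω => u k ω ⬝ᵥ (Sig k).mulVec (u k ω)) atTop (fun _ => 0)) :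
    TendstoInMeasure P (fun k ω => u k ω ⬝ᵥ (w k ω).ofLp) atTop (fun _ => 0) := by
  refine tendstoInProb_of_conditional_chebyshev (P := P) (U := u) (η := w) hum
    (fun k => (hw k).aemeasurable) hind (D := fun k a y => a ⬝ᵥ y.ofLp)
    (fun k => Continuous.measurable (by unfold Function.uncurry; fun_prop))
    (V := fun k ω => c * (u k ω ⬝ᵥ (Sig k).mulVec (u k ω)))
    (by simpa using tendstoInProb_const_mul c h) ?_
  intro k
  refine ae_of_all _ fun ω e he => ?_
  rw [(hw k).map_eq]
  refine (multivariateGaussian_linear_tail ((hSig k).smul hc) (u k ω) he).trans_eq ?_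
  simp only [Matrix.smul_mulVec, dotProduct_smul, smul_eq_mul]

/-- Integrating out a Gaussian vector that enters a complex exponential linearly, the other
arguments being independent of it. -/
theorem integral_cexp_gaussian_linear {N : ℕ} {Sig : Matrix (Fin N) (Fin N) ℝ}
    (hSig : Sig.PosSemidef) {E : Type*} [MeasurableSpace E] {U : Ω → E}
    {w : Ω → EuclideanSpace ℝ (Fin N)} (hU : AEMeasurable U P)
    (hw : HasLaw w (multivariateGaussian 0 Sig) P) (hind : IndepFun U w P)
    {ψ : E → ℝ} (hψ : Measurable ψ) {a : E → Fin N → ℝ} (ha : Measurable a) :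
    ∫ ω, Complex.exp (((ψ (U ω) + a (U ω) ⬝ᵥ (w ω).ofLp : ℝ) : ℂ) * Complex.I) ∂P =
      ∫ ω, Complex.exp ((ψ (U ω) : ℂ) * Complex.I) *
        Complex.exp (((-(a (U ω) ⬝ᵥ Sig.mulVec (a (U ω))) / 2 : ℝ) : ℂ)) ∂P := by
  have : IsProbabilityMeasure (P.map U) := Measure.isProbabilityMeasure_map hU
  have hf : Measurable (fun q : E × EuclideanSpace ℝ (Fin N) =>
      Complex.exp (((ψ q.1 + a q.1 ⬝ᵥ q.2.ofLp : ℝ) : ℂ) * Complex.I)) := by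
    simp only [dotProduct]
    fun_prop
  have hg : Measurable (fun q : E => Complex.exp ((ψ q : ℂ) * Complex.I) *
        Complex.exp (((-(a q ⬝ᵥ Sig.mulVec (a q)) / 2 : ℝ) : ℂ))) := by
    simp only [dotProduct, Matrix.mulVec]
    fun_prop
  have h1 : ∫ ω, Complex.exp (((ψ (U ω) + a (U ω) ⬝ᵥ (w ω).ofLp : ℝ) : ℂ) * Complex.I) ∂P =
      ∫ q, Complex.exp (((ψ q.1 + a q.1 ⬝ᵥ q.2.ofLp : ℝ) : ℂ) * Complex.I)
        ∂(P.map (fun ω => (U ω, w ω))) := by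
    rw [integral_map (hU.prodMk hw.aemeasurable) hf.aestronglyMeasurable]
  rw [h1, (indepFun_iff_map_prod_eq_prod_map_map hU hw.aemeasurable).1 hind, hw.map_eq,
    integral_prod, ← integral_map (φ := U) hU hg.aestronglyMeasurable]
  · congr 1
    ext q
    have h2 := charFun_multivariateGaussian (μ := 0) hSig (WithLp.toLp 2 (a q))
    rw [charFun_apply] at h2
    simp only [inner_zero_right, Complex.ofReal_zero, zero_mul, zero_sub] at h2
    rw [neg_div, Complex.ofReal_neg, Complex.ofReal_div, Complex.ofReal_ofNat, ← h2,
      ← integral_const_mul]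
    congr 1
    ext y
    rw [← Complex.exp_add, inner_eq_dotProduct, dotProduct_comm]
    push_cast
    ring_nf
  · refine Integrable.of_bound hf.aestronglyMeasurable 1 (ae_of_all _ fun q => ?_)
    rw [Complex.norm_exp_ofReal_mul_I]

/-- If `U` is independent of a pair of independent variables, then the second of the pair is
independent of `U` together with the first. -/
theorem indepFun_prodMk_of_indepFun_pair {E F G : Type*} [MeasurableSpace E] [MeasurableSpace F]
    [MeasurableSpace G] {U : Ω → E} {V : Ω → F} {W : Ω → G} (hU : AEMeasurable U P)
    (hV : AEMeasurable V P) (hW : AEMeasurable W P)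
    (h : IndepFun U (fun ω => (V ω, W ω)) P) (hVW : IndepFun V W P) :
    IndepFun (fun ω => (U ω, V ω)) W P := by
  have : IsProbabilityMeasure (P.map U) := Measure.isProbabilityMeasure_map hU
  have : IsProbabilityMeasure (P.map V) := Measure.isProbabilityMeasure_map hV
  have : IsProbabilityMeasure (P.map W) := Measure.isProbabilityMeasure_map hW
  have hUV : IndepFun U V P := h.comp measurable_id measurable_fst
  rw [indepFun_iff_map_prod_eq_prod_map_map (hU.prodMk hV) hW,
    (indepFun_iff_map_prod_eq_prod_map_map hU hV).1 hUV]
  have h1 := (indepFun_iff_map_prod_eq_prod_map_map hU (hV.prodMk hW)).1 h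
  rw [(indepFun_iff_map_prod_eq_prod_map_map hV hW).1 hVW, ← Measure.prodAssoc_prod] at h1
  have h2 := congrArg (Measure.map MeasurableEquiv.prodAssoc.symm) h1
  rw [MeasurableEquiv.map_symm_map, AEMeasurable.map_map_of_aemeasurable (by fun_prop)
    (by fun_prop)] at h2
  exact h2

end MatrixMeasurable

/-! ### The errors-in-variables model given the precision matrix -/

section Core

attribute [local instance] matrixMeasurableSpace matrix_borelSpace matrix_secondCountable

open scoped MatrixOrder RealInnerProductSpace

variable {Ω : Type*} [MeasurableSpace Ω] {P : Measure Ω} {p : ℕ}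

/-- The model expressed through the estimated precision matrix `B = S⁻¹`. The errors are indexed
by `Option (Fin p)`, the index `none` standing for the regression error. All trace conditions
are stated for `B Σ`, which is similar to the whitened covariance. -/
structure PrecisionModel (P : Measure Ω) (N : ℕ → ℕ) (X : ∀ k, Matrix (Fin (N k)) (Fin p) ℝ)
    (Sig : ∀ k, Matrix (Fin (N k)) (Fin (N k)) ℝ)
    (η : ∀ k, Option (Fin p) → Ω → EuclideanSpace ℝ (Fin (N k)))
    (B : ∀ k, Ω → Matrix (Fin (N k)) (Fin (N k)) ℝ)
    (Δ₁ Δ₂ : Matrix (Fin p) (Fin p) ℝ) (δ K : ℝ) : Prop where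
  tendsto_dim : Tendsto N atTop atTop
  posSemidef : ∀ k, (Sig k).PosSemidef
  hasLaw : ∀ k o, HasLaw (η k o) (multivariateGaussian 0 (Sig k)) P
  iIndep : ∀ k, iIndepFun (η k) P
  aemeasurable : ∀ k, AEMeasurable (B k) P
  indep : ∀ k, IndepFun (B k) (fun ω o => η k o ω) P
  posDef : ∀ k, ∀ᵐ ω ∂P, (B k ω).PosDef
  lim_design : TendstoInProbMatrix P
    (fun k ω => (N k : ℝ)⁻¹ • ((X k).transpose * B k ω * X k)) Δ₁
  lim_trace : TendstoInMeasure P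
    (fun k ω => (N k : ℝ)⁻¹ * (B k ω * Sig k).trace) atTop (fun _ => δ)
  lim_trace_sq : TendstoInMeasure P
    (fun k ω => (N k : ℝ)⁻¹ * (B k ω * Sig k * B k ω * Sig k).trace) atTop (fun _ => K)
  lim_weighted_design : TendstoInProbMatrix P
    (fun k ω => (N k : ℝ)⁻¹ • ((X k).transpose * B k ω * Sig k * B k ω * X k)) Δ₂
  lim_trace_fourth : TendstoInMeasure P
    (fun k ω => ((N k : ℝ) ^ 2)⁻¹ *
      (B k ω * Sig k * B k ω * Sig k * (B k ω * Sig k * B k ω * Sig k)).trace) atTop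
      (fun _ => 0)

/-- Linear combination of the errors with coefficients `a`. -/
noncomputable def comb {Ω : Type*} {n : ℕ} (η : Option (Fin p) → Ω → EuclideanSpace ℝ (Fin n))
    (a : Option (Fin p) → ℝ) (ω : Ω) : EuclideanSpace ℝ (Fin n) := ∑ o, a o • η o ω

/-- Coefficients of the residual `ε - ∑ βⱼ νⱼ`. -/
def residCoef (β : EuclideanSpace ℝ (Fin p)) : Option (Fin p) → ℝ :=
  fun o => o.elim 1 fun j => -β j

/-- Coefficients of the combination `∑ tⱼ νⱼ` of measurement errors. -/
def noiseCoef (t : Fin p → ℝ) : Option (Fin p) → ℝ := fun o => o.elim 0 t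

theorem observed_mulVec {Ω : Type*} {n : ℕ} (X : Matrix (Fin n) (Fin p) ℝ)
    (η : Option (Fin p) → Ω → EuclideanSpace ℝ (Fin n)) (ω : Ω) (t : Fin p → ℝ) :
    (observed X fun i => η (some i) ω).mulVec t =
      X.mulVec t + (comb η (noiseCoef t) ω).ofLp := by
  ext j
  simp [observed, comb, noiseCoef, Matrix.mulVec, dotProduct, add_mul, Finset.sum_add_distrib,
    Fintype.sum_option, mul_comm (t _)]

theorem comb_residCoef {Ω : Type*} {n : ℕ} (X : Matrix (Fin n) (Fin p) ℝ)
    (η : Option (Fin p) → Ω → EuclideanSpace ℝ (Fin n)) (ω : Ω) (β : EuclideanSpace ℝ (Fin p)) :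
    (comb η (residCoef β) ω).ofLp = (response X β (η none ω)).ofLp -
      (observed X fun i => η (some i) ω).mulVec β.ofLp := by
  rw [observed_mulVec]
  ext j
  simp [response, comb, noiseCoef, residCoef, Fintype.sum_option]
  ring

theorem sum_residCoef_sq (β : EuclideanSpace ℝ (Fin p)) :
    ∑ o, residCoef β o ^ 2 = 1 + ‖β‖ ^ 2 := by
  simp [residCoef, Fintype.sum_option, EuclideanSpace.real_norm_sq_eq]

theorem add_dotProduct_mulVec_add {n : ℕ} (A : Matrix (Fin n) (Fin n) ℝ) (x y z w : Fin n → ℝ) :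
    (x + y) ⬝ᵥ A.mulVec (z + w) =
      x ⬝ᵥ A.mulVec z + x ⬝ᵥ A.mulVec w + y ⬝ᵥ A.mulVec z + y ⬝ᵥ A.mulVec w := by
  simp only [Matrix.mulVec_add, add_dotProduct, dotProduct_add]
  ring

theorem mulVec_dotProduct_mulVec_mulVec {n : ℕ} (X Z : Matrix (Fin n) (Fin p) ℝ)
    (A : Matrix (Fin n) (Fin n) ℝ) (x y : Fin p → ℝ) :
    X.mulVec x ⬝ᵥ A.mulVec (Z.mulVec y) = x ⬝ᵥ (X.transpose * A * Z).mulVec y := by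
  rw [← Matrix.mulVec_mulVec, ← Matrix.mulVec_mulVec, Matrix.dotProduct_mulVec x,
    ← Matrix.mulVec_transpose, Matrix.transpose_transpose]

theorem transpose_mulVec_dotProduct {n : ℕ} (B A : Matrix (Fin n) (Fin n) ℝ) (hB : B.IsHermitian)
    (x : Fin n → ℝ) :
    B.transpose.mulVec x ⬝ᵥ A.mulVec (B.transpose.mulVec x) = x ⬝ᵥ (B * A * B).mulVec x := by
  have hs : B.transpose = B := by simpa using hB.eq
  rw [mulVec_dotProduct_mulVec_mulVec, Matrix.transpose_transpose, hs]

theorem tendstoInProb_dotProduct_mulVec {A : ℕ → Ω → Matrix (Fin p) (Fin p) ℝ}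
    {D : Matrix (Fin p) (Fin p) ℝ} (h : TendstoInProbMatrix P A D) (x y : Fin p → ℝ) :
    TendstoInMeasure P (fun k ω => x ⬝ᵥ (A k ω).mulVec y) atTop (fun _ => x ⬝ᵥ D.mulVec y) := by
  simp only [dotProduct, Matrix.mulVec, Finset.mul_sum]
  refine tendstoInProb_sum _ fun i _ => tendstoInProb_sum _ fun j _ => ?_
  have := tendstoInProb_const_mul (x i * y j) (h i j)
  have e : ∀ z : ℝ, x i * y j * z = x i * (z * y j) := fun z => by ring
  simpa only [e] using this

/-- A limit in probability of positive semidefinite matrices is positive semidefinite. -/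
theorem posSemidef_of_tendstoInProbMatrix [NeZero P] {A : ℕ → Ω → Matrix (Fin p) (Fin p) ℝ}
    {D : Matrix (Fin p) (Fin p) ℝ} (h : TendstoInProbMatrix P A D)
    (hA : ∀ k, ∀ᵐ ω ∂P, (A k ω).PosSemidef) : D.PosSemidef := by
  refine Matrix.PosSemidef.of_dotProduct_mulVec_nonneg ?_ fun x => ?_
  · ext i j
    refine eq_of_tendstoInProb (h j i) ((h i j).congr_left fun k => ?_)
    filter_upwards [hA k] with ω hω
    simpa using (hω.1.apply i j).symm
  · refine nonneg_of_tendstoInProb (tendstoInProb_dotProduct_mulVec h (star x) x) fun k => ?_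
    filter_upwards [hA k] with ω hω
    exact hω.dotProduct_mulVec_nonneg x

namespace PrecisionModel

variable {N : ℕ → ℕ} {X : ∀ k, Matrix (Fin (N k)) (Fin p) ℝ}
  {Sig : ∀ k, Matrix (Fin (N k)) (Fin (N k)) ℝ}
  {η : ∀ k, Option (Fin p) → Ω → EuclideanSpace ℝ (Fin (N k))}
  {B : ∀ k, Ω → Matrix (Fin (N k)) (Fin (N k)) ℝ}
  {Δ₁ Δ₂ : Matrix (Fin p) (Fin p) ℝ} {δ K : ℝ}

theorem hasLaw_comb [IsProbabilityMeasure P] (M : PrecisionModel P N X Sig η B Δ₁ Δ₂ δ K) (k : ℕ)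
    (a : Option (Fin p) → ℝ) :
    HasLaw (comb (η k) a) (multivariateGaussian 0 ((∑ o, a o ^ 2) • Sig k)) P :=
  hasLaw_sum_smul (M.posSemidef k) (M.hasLaw k) (M.iIndep k) a

theorem indep_comb (M : PrecisionModel P N X Sig η B Δ₁ Δ₂ δ K) (k : ℕ)
    (a : Option (Fin p) → ℝ) : IndepFun (B k) (comb (η k) a) P :=
  (M.indep k).comp measurable_id
    (by fun_prop : Measurable fun y : Option (Fin p) → EuclideanSpace ℝ (Fin (N k)) =>
      ∑ o, a o • y o)

theorem indep_comb_pair (M : PrecisionModel P N X Sig η B Δ₁ Δ₂ δ K) (k : ℕ)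
    (a b : Option (Fin p) → ℝ) :
    IndepFun (B k) (fun ω => (comb (η k) a ω, comb (η k) b ω)) P :=
  (M.indep k).comp measurable_id
    (by fun_prop : Measurable fun y : Option (Fin p) → EuclideanSpace ℝ (Fin (N k)) =>
      (∑ o, a o • y o, ∑ o, b o • y o))

theorem indep_comb_comb [IsProbabilityMeasure P] (M : PrecisionModel P N X Sig η B Δ₁ Δ₂ δ K)
    (k : ℕ)
    {a b : Option (Fin p) → ℝ} (hab : ∑ o, a o * b o = 0) :
    IndepFun (comb (η k) a) (comb (η k) b) P := by
  rw [indepFun_iff_map_prod_eq_prod_map_map (M.hasLaw_comb k a).aemeasurable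
    (M.hasLaw_comb k b).aemeasurable, (M.hasLaw_comb k a).map_eq, (M.hasLaw_comb k b).map_eq]
  exact map_sum_smul_prod_eq (M.posSemidef k) (M.hasLaw k) (M.iIndep k) hab

theorem tendsto_inv_dim (M : PrecisionModel P N X Sig η B Δ₁ Δ₂ δ K) :
    Tendsto (fun k => (N k : ℝ)⁻¹) atTop (𝓝 0) :=
  tendsto_inv_atTop_zero.comp (tendsto_natCast_atTop_atTop.comp M.tendsto_dim)

theorem lim_noise_sq [IsProbabilityMeasure P] (M : PrecisionModel P N X Sig η B Δ₁ Δ₂ δ K)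
    (a : Option (Fin p) → ℝ) :
    TendstoInMeasure P (fun k ω => (N k : ℝ)⁻¹ *
      ((comb (η k) a ω).ofLp ⬝ᵥ (B k ω).mulVec (comb (η k) a ω).ofLp)) atTop
      (fun _ => (∑ o, a o ^ 2) * δ) := by
  refine tendstoInProb_quadratic M.posSemidef (Finset.sum_nonneg fun o _ => sq_nonneg _)
    M.aemeasurable (fun k => M.hasLaw_comb k a) (fun k => M.indep_comb k a)
    (fun k => (M.posDef k).mono fun ω h => h.1) M.lim_trace ?_
  have := tendstoInProb_mul (tendstoInProb_of_tendsto (P := P) M.tendsto_inv_dim) M.lim_trace_sq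
  rw [zero_mul] at this
  refine this.congr_left fun k => ae_of_all _ fun ω => ?_
  simp only
  rw [← mul_assoc, pow_two, mul_inv]

/-- Bilinear forms of the errors concentrate; polarization reduces this to quadratic forms. -/
theorem lim_noise [IsProbabilityMeasure P] (M : PrecisionModel P N X Sig η B Δ₁ Δ₂ δ K)
    (a b : Option (Fin p) → ℝ) :
    TendstoInMeasure P (fun k ω => (N k : ℝ)⁻¹ *
      ((comb (η k) a ω).ofLp ⬝ᵥ (B k ω).mulVec (comb (η k) b ω).ofLp)) atTop
      (fun _ => (∑ o, a o * b o) * δ) := by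
  have h := tendstoInProb_const_mul 2⁻¹ (tendstoInProb_add (M.lim_noise_sq (a + b))
    (tendstoInProb_const_mul (-1) (tendstoInProb_add (M.lim_noise_sq a) (M.lim_noise_sq b))))
  have e : 2⁻¹ * ((∑ o, (a + b) o ^ 2) * δ + -1 * ((∑ o, a o ^ 2) * δ + (∑ o, b o ^ 2) * δ)) =
      (∑ o, a o * b o) * δ := by
    have : ∑ o, (a + b) o ^ 2 = ∑ o, a o ^ 2 + ∑ o, b o ^ 2 + 2 * ∑ o, a o * b o := by
      rw [Finset.mul_sum, ← Finset.sum_add_distrib, ← Finset.sum_add_distrib]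
      exact Finset.sum_congr rfl fun o _ => by simp only [Pi.add_apply]; ring
    rw [this]
    ring
  rw [e] at h
  refine h.congr_left fun k => ?_
  filter_upwards [M.posDef k] with ω hω
  have hc : comb (η k) (a + b) ω = comb (η k) a ω + comb (η k) b ω := by
    simp [comb, add_smul, Finset.sum_add_distrib]
  have hs : (B k ω).IsSymm := by simpa using hω.1
  rw [hc, WithLp.ofLp_add, add_dotProduct_mulVec_add,
    dotProduct_mulVec_comm_of_isSymm hs (comb (η k) b ω).ofLp (comb (η k) a ω).ofLp]
  ring

theorem lim_design_form (M : PrecisionModel P N X Sig η B Δ₁ Δ₂ δ K) (x y : Fin p → ℝ) :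
    TendstoInMeasure P (fun k ω => (N k : ℝ)⁻¹ *
      ((X k).mulVec x ⬝ᵥ (B k ω).mulVec ((X k).mulVec y))) atTop
      (fun _ => x ⬝ᵥ Δ₁.mulVec y) := by
  refine (tendstoInProb_dotProduct_mulVec M.lim_design x y).congr_left fun k =>
    ae_of_all _ fun ω => ?_
  simp only
  rw [mulVec_dotProduct_mulVec_mulVec, Matrix.smul_mulVec, dotProduct_smul, smul_eq_mul]

theorem lim_weighted_design_form (M : PrecisionModel P N X Sig η B Δ₁ Δ₂ δ K) (x : Fin p → ℝ) :
    TendstoInMeasure P (fun k ω => (N k : ℝ)⁻¹ *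
      ((B k ω).transpose.mulVec ((X k).mulVec x) ⬝ᵥ
        (Sig k).mulVec ((B k ω).transpose.mulVec ((X k).mulVec x)))) atTop
      (fun _ => x ⬝ᵥ Δ₂.mulVec x) := by
  refine (tendstoInProb_dotProduct_mulVec M.lim_weighted_design x x).congr_left fun k => ?_
  filter_upwards [M.posDef k] with ω hω
  rw [transpose_mulVec_dotProduct _ _ hω.1, mulVec_dotProduct_mulVec_mulVec, Matrix.smul_mulVec,
    dotProduct_smul, smul_eq_mul]
  simp only [Matrix.mul_assoc]

/-- The design and the errors are asymptotically orthogonal. -/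
theorem lim_cross [IsProbabilityMeasure P] (M : PrecisionModel P N X Sig η B Δ₁ Δ₂ δ K)
    (x : Fin p → ℝ)
    (a : Option (Fin p) → ℝ) :
    TendstoInMeasure P (fun k ω => (N k : ℝ)⁻¹ *
      ((X k).mulVec x ⬝ᵥ (B k ω).mulVec (comb (η k) a ω).ofLp)) atTop (fun _ => 0) := by
  have hcont : ∀ k, Continuous fun A : Matrix (Fin (N k)) (Fin (N k)) ℝ =>
      (N k : ℝ)⁻¹ • A.transpose.mulVec ((X k).mulVec x) := fun k => by fun_prop
  have h := tendstoInProb_linear (P := P) M.posSemidef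
    (u := fun k ω => (N k : ℝ)⁻¹ • (B k ω).transpose.mulVec ((X k).mulVec x))
    (w := fun k => comb (η k) a) (Finset.sum_nonneg fun o _ => sq_nonneg (a o))
    (fun k => (hcont k).measurable.comp_aemeasurable (M.aemeasurable k))
    (fun k => M.hasLaw_comb k a)
    (fun k => (M.indep_comb k a).comp (hcont k).measurable measurable_id) ?_
  · refine h.congr_left fun k => ae_of_all _ fun ω => ?_
    simp only
    rw [smul_dotProduct, smul_eq_mul, Matrix.dotProduct_mulVec, ← Matrix.mulVec_transpose]
  · have := tendstoInProb_mul (tendstoInProb_of_tendsto (P := P) M.tendsto_inv_dim)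
      (M.lim_weighted_design_form x)
    rw [zero_mul] at this
    refine this.congr_left fun k => ae_of_all _ fun ω => ?_
    simp only [Matrix.mulVec_smul, smul_dotProduct, dotProduct_smul, smul_eq_mul]

theorem lim_observed_form [IsProbabilityMeasure P] (M : PrecisionModel P N X Sig η B Δ₁ Δ₂ δ K)
    (x y : Fin p → ℝ) :
    TendstoInMeasure P (fun k ω => (N k : ℝ)⁻¹ *
      ((observed (X k) fun i => η k (some i) ω).mulVec x ⬝ᵥ
        (B k ω).mulVec ((observed (X k) fun i => η k (some i) ω).mulVec y))) atTop
      (fun _ => x ⬝ᵥ Δ₁.mulVec y + (x ⬝ᵥ y) * δ) := by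
  have h := tendstoInProb_add (tendstoInProb_add (tendstoInProb_add (M.lim_design_form x y)
    (M.lim_cross x (noiseCoef y))) (M.lim_cross y (noiseCoef x)))
    (M.lim_noise (noiseCoef x) (noiseCoef y))
  have e : ∑ o, noiseCoef x o * noiseCoef y o = x ⬝ᵥ y := by
    simp [noiseCoef, Fintype.sum_option, dotProduct]
  rw [e, add_zero, add_zero] at h
  refine h.congr_left fun k => ?_
  filter_upwards [M.posDef k] with ω hω
  have hs : (B k ω).IsSymm := by simpa using hω.1
  rw [observed_mulVec, observed_mulVec, add_dotProduct_mulVec_add,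
    dotProduct_mulVec_comm_of_isSymm hs (comb (η k) (noiseCoef x) ω).ofLp ((X k).mulVec y)]
  ring

theorem lim_lamHat [IsProbabilityMeasure P] (M : PrecisionModel P N X Sig η B Δ₁ Δ₂ δ K)
    (β : EuclideanSpace ℝ (Fin p)) :
    TendstoInMeasure P (fun k ω => lamHat (B k ω) (comb (η k) (residCoef β) ω) β) atTop
      (fun _ => δ) := by
  have hs := one_add_norm_sq_pos β
  have h := tendstoInProb_const_mul (1 + ‖β‖ ^ 2)⁻¹ (M.lim_noise_sq (residCoef β))
  rw [sum_residCoef_sq, inv_mul_cancel_left₀ hs.ne'] at h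
  refine h.congr_left fun k => ae_of_all _ fun ω => ?_
  simp only [lamHat]
  rw [inv_mul_eq_div]

/-- The curvature matrix of the recentred objective is consistent for `Δ₁`. -/
theorem lim_curvature [IsProbabilityMeasure P] (M : PrecisionModel P N X Sig η B Δ₁ Δ₂ δ K)
    (β : EuclideanSpace ℝ (Fin p)) :
    TendstoInProbMatrix P (fun k ω => curvature (B k ω) (observed (X k) fun i => η k (some i) ω)
      (comb (η k) (residCoef β) ω) β) Δ₁ := by
  intro i j
  have h := tendstoInProb_add (M.lim_observed_form (Pi.single i 1) (Pi.single j 1))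
    (tendstoInProb_const_mul (-(1 : Matrix (Fin p) (Fin p) ℝ) i j) (M.lim_lamHat β))
  have e : (Pi.single i 1 : Fin p → ℝ) ⬝ᵥ Pi.single j 1 = (1 : Matrix (Fin p) (Fin p) ℝ) i j := by
    simp [Matrix.one_apply, Pi.single_apply, eq_comm]
  have e' : ∀ A : Matrix (Fin p) (Fin p) ℝ,
      (Pi.single i 1 : Fin p → ℝ) ⬝ᵥ A.mulVec (Pi.single j 1) = A i j := fun A => by simp
  rw [e, e', neg_mul, add_neg_cancel_right] at h
  refine h.congr_left fun k => ae_of_all _ fun ω => ?_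
  simp only [curvature]
  rw [mulVec_dotProduct_mulVec_mulVec, e']
  simp only [Matrix.sub_apply, Matrix.smul_apply, smul_eq_mul]
  ring

/-- The conditional variance of the bilinear part of the score stabilizes: it is a quadratic form
of the errors with kernel `B Σ B`. -/
theorem lim_resid_weighted [IsProbabilityMeasure P] (M : PrecisionModel P N X Sig η B Δ₁ Δ₂ δ K)
    (a : Option (Fin p) → ℝ) :
    TendstoInMeasure P (fun k ω => (N k : ℝ)⁻¹ *
      ((B k ω).transpose.mulVec (comb (η k) a ω).ofLp ⬝ᵥ
        (Sig k).mulVec ((B k ω).transpose.mulVec (comb (η k) a ω).ofLp))) atTop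
      (fun _ => (∑ o, a o ^ 2) * K) := by
  have hcont : ∀ k, Continuous fun A : Matrix (Fin (N k)) (Fin (N k)) ℝ => A * Sig k * A :=
    fun k => by fun_prop
  have h := tendstoInProb_quadratic (P := P) M.posSemidef
    (Q := fun k ω => B k ω * Sig k * B k ω) (w := fun k => comb (η k) a) (τ := K)
    (Finset.sum_nonneg fun o _ => sq_nonneg (a o))
    (fun k => (hcont k).measurable.comp_aemeasurable (M.aemeasurable k))
    (fun k => M.hasLaw_comb k a)
    (fun k => (M.indep_comb k a).comp (hcont k).measurable measurable_id) ?_ M.lim_trace_sq ?_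
  · refine h.congr_left fun k => ?_
    filter_upwards [M.posDef k] with ω hω
    rw [transpose_mulVec_dotProduct _ _ hω.1]
  · intro k
    filter_upwards [M.posDef k] with ω hω
    have := Matrix.isHermitian_conjTranspose_mul_mul (B k ω) (M.posSemidef k).1
    rwa [hω.1.eq] at this
  · refine M.lim_trace_fourth.congr_left fun k => ae_of_all _ fun ω => ?_
    simp only [mul_assoc]

end PrecisionModel

end Core

/-! ### The central limit theorem for the score -/

section CentralLimit

attribute [local instance] matrixMeasurableSpace matrix_borelSpace matrix_secondCountable

open scoped MatrixOrder RealInnerProductSpace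

variable {Ω : Type*} [MeasurableSpace Ω] {P : Measure Ω} [IsProbabilityMeasure P] {p : ℕ}
  {N : ℕ → ℕ} {X : ∀ k, Matrix (Fin (N k)) (Fin p) ℝ}
  {Sig : ∀ k, Matrix (Fin (N k)) (Fin (N k)) ℝ}
  {η : ∀ k, Option (Fin p) → Ω → EuclideanSpace ℝ (Fin (N k))}
  {B : ∀ k, Ω → Matrix (Fin (N k)) (Fin (N k)) ℝ}
  {Δ₁ Δ₂ : Matrix (Fin p) (Fin p) ℝ} {δ K : ℝ}

theorem inv_sqrt_mul_inv_sqrt (x : ℕ) : (√(x : ℝ))⁻¹ * (√(x : ℝ))⁻¹ = (x : ℝ)⁻¹ := by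
  rw [← mul_inv, Real.mul_self_sqrt (Nat.cast_nonneg _)]

theorem norm_cexp_neg_le_one {x : ℝ} (hx : 0 ≤ x) : ‖Complex.exp ((-x / 2 : ℝ) : ℂ)‖ ≤ 1 := by
  rw [Complex.norm_exp_ofReal, Real.exp_le_one_iff]
  linarith

/-- A random phase times a factor converging in probability to a constant: the factor may be
replaced by its limit inside the expectation. -/
theorem tendsto_integral_phase_mul {φ : ℕ → Ω → ℝ} {q : ℕ → Ω → ℝ} {l : ℝ} {L : ℂ}
    (hφ : ∀ k, AEMeasurable (φ k) P) (hqm : ∀ k, AEMeasurable (q k) P) (hq : ∀ k ω, 0 ≤ q k ω)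
    (hlim : TendstoInMeasure P q atTop (fun _ => l))
    (h : Tendsto (fun k => ∫ ω, Complex.exp ((φ k ω : ℂ) * Complex.I) ∂P) atTop (𝓝 L)) :
    Tendsto (fun k => ∫ ω, Complex.exp ((φ k ω : ℂ) * Complex.I) *
      Complex.exp ((-q k ω / 2 : ℝ) : ℂ) ∂P) atTop (𝓝 (L * Complex.exp ((-l / 2 : ℝ) : ℂ))) := by
  set c := Complex.exp ((-l / 2 : ℝ) : ℂ) with hc
  have hl : 0 ≤ l := nonneg_of_tendstoInProb hlim fun k => ae_of_all _ (hq k)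
  have hE : TendstoInMeasure P (fun k ω => Complex.exp ((-q k ω / 2 : ℝ) : ℂ) - c) atTop
      (fun _ => 0) := by
    have := tendstoInProb_continuousAt hlim
      (g := fun x : ℝ => Complex.exp ((-x / 2 : ℝ) : ℂ) - c)
      (by fun_prop : Continuous fun x : ℝ => Complex.exp ((-x / 2 : ℝ) : ℂ) - c).continuousAt
    simpa only [← hc, sub_self] using this
  have hmφ : ∀ k, AEStronglyMeasurable (fun ω => Complex.exp ((φ k ω : ℂ) * Complex.I)) P :=
    fun k => AEMeasurable.aestronglyMeasurable (by have := hφ k; fun_prop)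
  have hmq : ∀ k, AEStronglyMeasurable (fun ω => Complex.exp ((-q k ω / 2 : ℝ) : ℂ)) P :=
    fun k => AEMeasurable.aestronglyMeasurable (by have := hqm k; fun_prop)
  have hb : ∀ k ω, ‖Complex.exp ((φ k ω : ℂ) * Complex.I) *
      (Complex.exp ((-q k ω / 2 : ℝ) : ℂ) - c)‖ ≤ 2 := by
    intro k ω
    rw [norm_mul, Complex.norm_exp_ofReal_mul_I, one_mul]
    refine (norm_sub_le _ _).trans ?_
    have := norm_cexp_neg_le_one (hq k ω)
    have := norm_cexp_neg_le_one hl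
    linarith
  have hdiff := tendsto_integral_of_tendstoInProb (P := P) (c := 0) (b := 2)
    (U := fun k ω => Complex.exp ((φ k ω : ℂ) * Complex.I) *
      (Complex.exp ((-q k ω / 2 : ℝ) : ℂ) - c))
    (fun k => (hmφ k).mul ((hmq k).sub aestronglyMeasurable_const))
    (fun k => ae_of_all _ (hb k)) (by
      have hnorm := tendstoInProb_continuousAt hE (g := fun z : ℂ => ‖z‖)
        continuous_norm.continuousAt
      rw [norm_zero] at hnorm
      refine tendstoInProb_zero_of_le (bad := fun _ => ∅) hnorm (by simp)
        (Eventually.of_forall fun k => ae_of_all _ fun ω _ => ?_)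
      rw [norm_mul, Complex.norm_exp_ofReal_mul_I, one_mul])
  have hsum := hdiff.add (h.mul_const c)
  rw [zero_add] at hsum
  refine hsum.congr fun k => ?_
  rw [← integral_mul_const, ← integral_add]
  · congr 1
    ext ω
    ring
  · exact Integrable.of_bound ((hmφ k).mul ((hmq k).sub aestronglyMeasurable_const)) 2
      (ae_of_all _ (hb k))
  · refine (Integrable.of_bound (hmφ k) 1 (ae_of_all _ fun ω => ?_)).mul_const c
    rw [Complex.norm_exp_ofReal_mul_I]

namespace PrecisionModel

/-- The part of the score that is linear in the errors is asymptotically Gaussian. -/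
theorem tendsto_integral_linear_part (M : PrecisionModel P N X Sig η B Δ₁ Δ₂ δ K)
    (t : Fin p → ℝ) (a : Option (Fin p) → ℝ) :
    Tendsto (fun k => ∫ ω, Complex.exp ((((√(N k : ℝ))⁻¹ *
      ((X k).mulVec t ⬝ᵥ (B k ω).mulVec (comb (η k) a ω).ofLp) : ℝ) : ℂ) * Complex.I) ∂P) atTop
      (𝓝 (Complex.exp ((-((∑ o, a o ^ 2) * (t ⬝ᵥ Δ₂.mulVec t)) / 2 : ℝ) : ℂ))) := by
  have ha : 0 ≤ ∑ o, a o ^ 2 := Finset.sum_nonneg fun o _ => sq_nonneg _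
  have hcont : ∀ k, Continuous fun A : Matrix (Fin (N k)) (Fin (N k)) ℝ =>
      (√(N k : ℝ))⁻¹ • A.transpose.mulVec ((X k).mulVec t) := fun k => by fun_prop
  have hlim := tendstoInProb_const_mul (∑ o, a o ^ 2) (M.lim_weighted_design_form t)
  have h := tendsto_integral_phase_mul (P := P) (φ := fun _ _ => 0) (L := 1)
    (q := fun k ω => (∑ o, a o ^ 2) * ((N k : ℝ)⁻¹ *
      ((B k ω).transpose.mulVec ((X k).mulVec t) ⬝ᵥ
        (Sig k).mulVec ((B k ω).transpose.mulVec ((X k).mulVec t)))))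
    (fun k => aemeasurable_const) ?_ ?_ hlim (by simp)
  · rw [one_mul] at h
    refine h.congr fun k => ?_
    have h1 := integral_cexp_gaussian_linear (P := P) ((M.posSemidef k).smul ha)
      (M.aemeasurable k) (M.hasLaw_comb k a) (M.indep_comb k a) (ψ := fun _ => 0)
      measurable_const (hcont k).measurable
    have e1 : ∀ ω, (0 : ℝ) + ((√(N k : ℝ))⁻¹ • (B k ω).transpose.mulVec ((X k).mulVec t)) ⬝ᵥ
        (comb (η k) a ω).ofLp = (√(N k : ℝ))⁻¹ *
          ((X k).mulVec t ⬝ᵥ (B k ω).mulVec (comb (η k) a ω).ofLp) := by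
      intro ω
      rw [zero_add, smul_dotProduct, smul_eq_mul, Matrix.dotProduct_mulVec,
        ← Matrix.mulVec_transpose]
    simp_rw [e1] at h1
    rw [h1]
    congr 1
    ext ω
    congr 4
    simp only [Matrix.mulVec_smul, Matrix.smul_mulVec, smul_dotProduct, dotProduct_smul,
      smul_eq_mul]
    rw [← inv_sqrt_mul_inv_sqrt]
    ring
  · intro k
    have : Continuous fun A : Matrix (Fin (N k)) (Fin (N k)) ℝ =>
        (∑ o, a o ^ 2) * ((N k : ℝ)⁻¹ * (A.transpose.mulVec ((X k).mulVec t) ⬝ᵥ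
        (Sig k).mulVec (A.transpose.mulVec ((X k).mulVec t)))) := by fun_prop
    exact this.measurable.comp_aemeasurable (M.aemeasurable k)
  · intro k ω
    exact mul_nonneg ha (mul_nonneg (by positivity)
      ((M.posSemidef k).dotProduct_mulVec_nonneg _))

/-- Characteristic function of the linear and bilinear parts jointly: conditionally on the
residual direction the bilinear part is Gaussian, with conditional variance converging in
probability. -/
theorem tendsto_integral_score_part (M : PrecisionModel P N X Sig η B Δ₁ Δ₂ δ K)
    (t : Fin p → ℝ) {a b : Option (Fin p) → ℝ} (hab : ∑ o, a o * b o = 0) :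
    Tendsto (fun k => ∫ ω, Complex.exp ((((√(N k : ℝ))⁻¹ *
      ((X k).mulVec t ⬝ᵥ (B k ω).mulVec (comb (η k) a ω).ofLp) + (√(N k : ℝ))⁻¹ *
      ((comb (η k) a ω).ofLp ⬝ᵥ (B k ω).mulVec (comb (η k) b ω).ofLp) : ℝ) : ℂ) *
        Complex.I) ∂P) atTop
      (𝓝 (Complex.exp ((-((∑ o, a o ^ 2) * (t ⬝ᵥ Δ₂.mulVec t)) / 2 : ℝ) : ℂ) *
        Complex.exp ((-((∑ o, b o ^ 2) * ((∑ o, a o ^ 2) * K)) / 2 : ℝ) : ℂ))) := by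
  have hb : 0 ≤ ∑ o, b o ^ 2 := Finset.sum_nonneg fun o _ => sq_nonneg _
  have hU : ∀ k, AEMeasurable (fun ω => (B k ω, comb (η k) a ω)) P := fun k =>
    (M.aemeasurable k).prodMk (M.hasLaw_comb k a).aemeasurable
  have hψ : ∀ k, Continuous fun q : Matrix (Fin (N k)) (Fin (N k)) ℝ ×
      EuclideanSpace ℝ (Fin (N k)) => (√(N k : ℝ))⁻¹ *
        ((X k).mulVec t ⬝ᵥ q.1.mulVec q.2.ofLp) := fun k => by fun_prop
  have ha' : ∀ k, Continuous fun q : Matrix (Fin (N k)) (Fin (N k)) ℝ ×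
      EuclideanSpace ℝ (Fin (N k)) => (√(N k : ℝ))⁻¹ • q.1.transpose.mulVec q.2.ofLp :=
    fun k => by fun_prop
  have hφm : ∀ k, AEMeasurable (fun ω => (√(N k : ℝ))⁻¹ *
      ((X k).mulVec t ⬝ᵥ (B k ω).mulVec (comb (η k) a ω).ofLp)) P := fun k => by
    simpa only [Function.comp_def] using (hψ k).measurable.comp_aemeasurable (hU k)
  have hqm : ∀ k, AEMeasurable (fun ω => (∑ o, b o ^ 2) * ((N k : ℝ)⁻¹ *
      ((B k ω).transpose.mulVec (comb (η k) a ω).ofLp ⬝ᵥ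
        (Sig k).mulVec ((B k ω).transpose.mulVec (comb (η k) a ω).ofLp)))) P := fun k => by
    have : Continuous fun q : Matrix (Fin (N k)) (Fin (N k)) ℝ × EuclideanSpace ℝ (Fin (N k)) =>
        (∑ o, b o ^ 2) * ((N k : ℝ)⁻¹ * (q.1.transpose.mulVec q.2.ofLp ⬝ᵥ
        (Sig k).mulVec (q.1.transpose.mulVec q.2.ofLp))) := by fun_prop
    simpa only [Function.comp_def] using this.measurable.comp_aemeasurable (hU k)
  have hlim := tendstoInProb_const_mul (∑ o, b o ^ 2) (M.lim_resid_weighted a)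
  have h := tendsto_integral_phase_mul (P := P) (φ := fun k ω => (√(N k : ℝ))⁻¹ *
      ((X k).mulVec t ⬝ᵥ (B k ω).mulVec (comb (η k) a ω).ofLp))
    hφm hqm ?_ hlim
    (M.tendsto_integral_linear_part t a)
  · refine h.congr fun k => ?_
    have h1 := integral_cexp_gaussian_linear (P := P) ((M.posSemidef k).smul hb)
      (hU k) (M.hasLaw_comb k b)
      (indepFun_prodMk_of_indepFun_pair (M.aemeasurable k) (M.hasLaw_comb k a).aemeasurable
        (M.hasLaw_comb k b).aemeasurable (M.indep_comb_pair k a b) (M.indep_comb_comb k hab))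
      (hψ k).measurable (ha' k).measurable
    have e1 : ∀ ω, ((√(N k : ℝ))⁻¹ • (B k ω).transpose.mulVec (comb (η k) a ω).ofLp) ⬝ᵥ
        (comb (η k) b ω).ofLp = (√(N k : ℝ))⁻¹ *
          ((comb (η k) a ω).ofLp ⬝ᵥ (B k ω).mulVec (comb (η k) b ω).ofLp) := by
      intro ω
      rw [smul_dotProduct, smul_eq_mul, Matrix.dotProduct_mulVec, ← Matrix.mulVec_transpose]
    simp_rw [e1] at h1
    rw [h1]
    congr 1
    ext ω
    congr 4
    simp only [Matrix.mulVec_smul, Matrix.smul_mulVec, smul_dotProduct, dotProduct_smul,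
      smul_eq_mul]
    rw [← inv_sqrt_mul_inv_sqrt]
    ring
  · intro k ω
    exact mul_nonneg hb (mul_nonneg (by positivity)
      ((M.posSemidef k).dotProduct_mulVec_nonneg _))

end PrecisionModel

/-- Coefficients of the combination of errors that appears in the score in the direction `t`:
the measurement error `∑ tⱼ νⱼ` with its projection on the residual removed. -/
noncomputable def scoreCoef (β : EuclideanSpace ℝ (Fin p)) (t : Fin p → ℝ) : Option (Fin p) → ℝ :=
  noiseCoef t + ((t ⬝ᵥ β.ofLp) / (1 + ‖β‖ ^ 2)) • residCoef β

theorem sum_residCoef_mul_noiseCoef (β : EuclideanSpace ℝ (Fin p)) (t : Fin p → ℝ) :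
    ∑ o, residCoef β o * noiseCoef t o = -(t ⬝ᵥ β.ofLp) := by
  simp [residCoef, noiseCoef, Fintype.sum_option, dotProduct, mul_comm]

theorem sum_noiseCoef_sq (t : Fin p → ℝ) : ∑ o, noiseCoef t o ^ 2 = t ⬝ᵥ t := by
  simp [noiseCoef, Fintype.sum_option, dotProduct, pow_two]

theorem sum_residCoef_mul_scoreCoef (β : EuclideanSpace ℝ (Fin p)) (t : Fin p → ℝ) :
    ∑ o, residCoef β o * scoreCoef β t o = 0 := by
  have hs := one_add_norm_sq_pos β
  have h : ∀ o, residCoef β o * scoreCoef β t o = residCoef β o * noiseCoef t o +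
      ((t ⬝ᵥ β.ofLp) / (1 + ‖β‖ ^ 2)) * residCoef β o ^ 2 := fun o => by
    simp only [scoreCoef, Pi.add_apply, Pi.smul_apply, smul_eq_mul]
    ring
  simp_rw [h]
  rw [Finset.sum_add_distrib, ← Finset.mul_sum, sum_residCoef_mul_noiseCoef, sum_residCoef_sq,
    div_mul_cancel₀ _ hs.ne', neg_add_cancel]

theorem sum_scoreCoef_sq (β : EuclideanSpace ℝ (Fin p)) (t : Fin p → ℝ) :
    ∑ o, scoreCoef β t o ^ 2 = t ⬝ᵥ t - (t ⬝ᵥ β.ofLp) ^ 2 / (1 + ‖β‖ ^ 2) := by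
  have hs := one_add_norm_sq_pos β
  have h : ∀ o, scoreCoef β t o ^ 2 = noiseCoef t o ^ 2 +
      2 * ((t ⬝ᵥ β.ofLp) / (1 + ‖β‖ ^ 2)) * (residCoef β o * noiseCoef t o) +
      ((t ⬝ᵥ β.ofLp) / (1 + ‖β‖ ^ 2)) ^ 2 * residCoef β o ^ 2 := fun o => by
    simp only [scoreCoef, Pi.add_apply, Pi.smul_apply, smul_eq_mul]
    ring
  simp_rw [h]
  rw [Finset.sum_add_distrib, Finset.sum_add_distrib, ← Finset.mul_sum, ← Finset.mul_sum,
    sum_residCoef_mul_noiseCoef, sum_residCoef_sq, sum_noiseCoef_sq]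
  field_simp
  ring

/-- The Sherman–Morrison formula for `(I + ββᵀ)⁻¹`. -/
theorem inv_one_add_vecMulVec (β : EuclideanSpace ℝ (Fin p)) :
    (1 + Matrix.vecMulVec β.ofLp β.ofLp)⁻¹ =
      1 - (1 + ‖β‖ ^ 2)⁻¹ • Matrix.vecMulVec β.ofLp β.ofLp := by
  have hs := one_add_norm_sq_pos β
  refine Matrix.inv_eq_right_inv ?_
  have h : Matrix.vecMulVec β.ofLp β.ofLp * Matrix.vecMulVec β.ofLp β.ofLp =
      ‖β‖ ^ 2 • Matrix.vecMulVec β.ofLp β.ofLp := by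
    rw [Matrix.vecMulVec_mul_vecMulVec, ← inner_eq_dotProduct, real_inner_self_eq_norm_sq]
    simp [Matrix.vecMulVec_smul]
  rw [add_mul, mul_sub, mul_sub, Matrix.mul_smul, Matrix.mul_smul, h, smul_smul, one_mul, one_mul,
    mul_one, sub_add_sub_comm, ← add_smul, ← mul_one_add, inv_mul_cancel₀ hs.ne', one_smul]
  abel

/-- The asymptotic covariance matrix of the score. -/
noncomputable def scoreCov (Δ₂ : Matrix (Fin p) (Fin p) ℝ) (K : ℝ)
    (β : EuclideanSpace ℝ (Fin p)) : Matrix (Fin p) (Fin p) ℝ :=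
  (1 + β.ofLp ⬝ᵥ β.ofLp) • (Δ₂ + K • (1 + Matrix.vecMulVec β.ofLp β.ofLp)⁻¹)

theorem dotProduct_scoreCov_mulVec (β : EuclideanSpace ℝ (Fin p)) (t : Fin p → ℝ) :
    t ⬝ᵥ (scoreCov Δ₂ K β).mulVec t = (∑ o, residCoef β o ^ 2) * (t ⬝ᵥ Δ₂.mulVec t) +
      (∑ o, scoreCoef β t o ^ 2) * ((∑ o, residCoef β o ^ 2) * K) := by
  have hs := one_add_norm_sq_pos β
  rw [scoreCov, inv_one_add_vecMulVec, sum_scoreCoef_sq, sum_residCoef_sq,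
    ← inner_eq_dotProduct β β, real_inner_self_eq_norm_sq]
  simp only [Matrix.smul_mulVec, Matrix.add_mulVec, Matrix.sub_mulVec, Matrix.one_mulVec,
    dotProduct_add, dotProduct_sub, dotProduct_smul, smul_eq_mul, Matrix.vecMulVec_mulVec,
    MulOpposite.smul_eq_mul_unop, MulOpposite.unop_op]
  rw [dotProduct_comm β.ofLp t]
  simp
  ring

theorem posSemidef_scoreCov (hΔ₂ : Δ₂.PosSemidef) (hK : 0 ≤ K) (β : EuclideanSpace ℝ (Fin p)) :
    (scoreCov Δ₂ K β).PosSemidef := by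
  have h0 : (0 : ℝ) ≤ 1 + β.ofLp ⬝ᵥ β.ofLp := by
    rw [← inner_eq_dotProduct β β, real_inner_self_eq_norm_sq]
    positivity
  have h1 : (Matrix.vecMulVec β.ofLp β.ofLp).PosSemidef := by
    simpa using Matrix.posSemidef_vecMulVec_self_star β.ofLp
  exact (hΔ₂.add ((Matrix.PosSemidef.one.add h1).inv.smul hK)).smul h0

namespace PrecisionModel

/-- The score of the model. -/
noncomputable abbrev modelScore {Ω : Type*} (X : ∀ k, Matrix (Fin (N k)) (Fin p) ℝ)
    (η : ∀ k, Option (Fin p) → Ω → EuclideanSpace ℝ (Fin (N k)))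
    (B : ∀ k, Ω → Matrix (Fin (N k)) (Fin (N k)) ℝ) (β : EuclideanSpace ℝ (Fin p)) (k : ℕ)
    (ω : Ω) : EuclideanSpace ℝ (Fin p) :=
  score (B k ω) (observed (X k) fun i => η k (some i) ω) (comb (η k) (residCoef β) ω) β

theorem inner_sqrt_smul_modelScore {Ω : Type*}
    {η : ∀ k, Option (Fin p) → Ω → EuclideanSpace ℝ (Fin (N k))}
    {B : ∀ k, Ω → Matrix (Fin (N k)) (Fin (N k)) ℝ} {k : ℕ} {ω : Ω} (hB : (B k ω).IsSymm)
    (β t : EuclideanSpace ℝ (Fin p)) :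
    ⟪√(N k : ℝ) • modelScore X η B β k ω, t⟫ = (√(N k : ℝ))⁻¹ *
      ((X k).mulVec t.ofLp ⬝ᵥ (B k ω).mulVec (comb (η k) (residCoef β) ω).ofLp) +
      (√(N k : ℝ))⁻¹ * ((comb (η k) (residCoef β) ω).ofLp ⬝ᵥ
        (B k ω).mulVec (comb (η k) (scoreCoef β t.ofLp) ω).ofLp) := by
  have h1 : comb (η k) (scoreCoef β t.ofLp) ω = comb (η k) (noiseCoef t.ofLp) ω +
      ((t.ofLp ⬝ᵥ β.ofLp) / (1 + ‖β‖ ^ 2)) • comb (η k) (residCoef β) ω := by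
    simp only [comb, scoreCoef, Pi.add_apply, Pi.smul_apply, add_smul, Finset.sum_add_distrib,
      Finset.smul_sum, smul_assoc]
  have h2 : √(N k : ℝ) * (N k : ℝ)⁻¹ = (√(N k : ℝ))⁻¹ := by
    rw [← inv_sqrt_mul_inv_sqrt, ← mul_assoc]
    rcases eq_or_ne (√(N k : ℝ)) 0 with h | h
    · simp [h]
    · rw [mul_inv_cancel₀ h, one_mul]
  have h3 : ((observed (X k) fun i => η k (some i) ω).transpose * B k ω).mulVec
      (comb (η k) (residCoef β) ω).ofLp ⬝ᵥ t.ofLp =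
      (X k).mulVec t.ofLp ⬝ᵥ (B k ω).mulVec (comb (η k) (residCoef β) ω).ofLp +
      (comb (η k) (residCoef β) ω).ofLp ⬝ᵥ
        (B k ω).mulVec (comb (η k) (noiseCoef t.ofLp) ω).ofLp := by
    rw [← Matrix.mulVec_mulVec, dotProduct_comm _ t.ofLp, Matrix.dotProduct_mulVec,
      ← Matrix.mulVec_transpose, Matrix.transpose_transpose, observed_mulVec, add_dotProduct,
      dotProduct_mulVec_comm_of_isSymm hB (comb (η k) (noiseCoef t.ofLp) ω).ofLp]
  rw [inner_eq_dotProduct, h1, ← h2]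
  simp only [score, WithLp.ofLp_add, WithLp.ofLp_smul, smul_dotProduct, add_dotProduct, smul_eq_mul,
    h3, lamHat, Matrix.mulVec_add, Matrix.mulVec_smul, dotProduct_add, dotProduct_smul]
  rw [dotProduct_comm β.ofLp t.ofLp]
  ring

theorem aemeasurable_modelScore {P : Measure Ω}
    (M : PrecisionModel P N X Sig η B Δ₁ Δ₂ δ K)
    (β : EuclideanSpace ℝ (Fin p)) (k : ℕ) : AEMeasurable (modelScore X η B β k) P := by
  have h1 : Continuous fun q : Matrix (Fin (N k)) (Fin (N k)) ℝ ×
      (Option (Fin p) → EuclideanSpace ℝ (Fin (N k))) =>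
      observed (X k) fun i => q.2 (some i) := by
    refine continuous_matrix fun i j => ?_
    simp only [observed, Matrix.of_apply]
    fun_prop
  have h2 : Continuous fun q : Matrix (Fin (N k)) (Fin (N k)) ℝ ×
      (Option (Fin p) → EuclideanSpace ℝ (Fin (N k))) =>
      score q.1 (observed (X k) fun i => q.2 (some i)) (∑ o, residCoef β o • q.2 o) β := by
    unfold score lamHat
    fun_prop
  have h3 : AEMeasurable (fun ω => (B k ω, fun o => η k o ω)) P := (M.aemeasurable k).prodMk
    (aemeasurable_pi_lambda _ fun o => (M.hasLaw k o).aemeasurable)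
  have h4 := h2.measurable.comp_aemeasurable h3
  simp only [Function.comp_def] at h4
  exact h4

/-- Central limit theorem for the score. -/
theorem tendstoInDistribution_modelScore (M : PrecisionModel P N X Sig η B Δ₁ Δ₂ δ K)
    (hK : 0 ≤ K) (hΔ₂ : Δ₂.PosSemidef) (β : EuclideanSpace ℝ (Fin p)) :
    TendstoInDistribution (fun k ω => √(N k : ℝ) • modelScore X η B β k ω) atTop id (fun _ => P)
      (multivariateGaussian 0 (scoreCov Δ₂ K β)) := by
  have hm : ∀ k, AEMeasurable (fun ω => √(N k : ℝ) • modelScore X η B β k ω) P := fun k =>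
    (M.aemeasurable_modelScore β k).const_smul (√(N k : ℝ))
  refine ⟨hm, aemeasurable_id, ProbabilityMeasure.tendsto_of_tendsto_charFun fun t => ?_⟩
  simp only [ProbabilityMeasure.coe_mk, Measure.map_id]
  rw [charFun_multivariateGaussian (posSemidef_scoreCov hΔ₂ hK β)]
  have h := M.tendsto_integral_score_part t.ofLp (sum_residCoef_mul_scoreCoef β t.ofLp)
  rw [← Complex.exp_add, ← Complex.ofReal_add, ← add_div, ← neg_add,
    ← dotProduct_scoreCov_mulVec] at h
  have e : (((⟪t, (0 : EuclideanSpace ℝ (Fin p))⟫ : ℝ) : ℂ) * Complex.I -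
      ((t.ofLp ⬝ᵥ (scoreCov Δ₂ K β).mulVec t.ofLp : ℝ) : ℂ) / 2) =
      ((-(t.ofLp ⬝ᵥ (scoreCov Δ₂ K β).mulVec t.ofLp) / 2 : ℝ) : ℂ) := by
    rw [inner_zero_right]
    push_cast
    ring
  rw [e]
  refine h.congr fun k => ?_
  rw [charFun_apply, integral_map (hm k) (Continuous.aestronglyMeasurable (by fun_prop))]
  refine integral_congr_ae ?_
  filter_upwards [M.posDef k] with ω hω
  rw [inner_sqrt_smul_modelScore (by simpa using hω.1)]

end PrecisionModel

end CentralLimit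

/-! ### Linearization of the estimator -/

section Linearization

attribute [local instance] matrixMeasurableSpace matrix_borelSpace matrix_secondCountable

open scoped MatrixOrder RealInnerProductSpace

theorem exists_coercive_of_posDef {p : ℕ} {D : Matrix (Fin p) (Fin p) ℝ} (hD : D.PosDef) :
    ∃ c : ℝ, 0 < c ∧ ∀ d : EuclideanSpace ℝ (Fin p),
      c * ‖d‖ ^ 2 ≤ ⟪d, Matrix.toEuclideanCLM (𝕜 := ℝ) D d⟫ := by
  rcases (Metric.sphere (0 : EuclideanSpace ℝ (Fin p)) 1).eq_empty_or_nonempty with h | h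
  · refine ⟨1, one_pos, fun d => ?_⟩
    have : d = 0 := by
      by_contra hd
      have : ‖d‖⁻¹ • d ∈ Metric.sphere (0 : EuclideanSpace ℝ (Fin p)) 1 := by
        simp [norm_smul, norm_ne_zero_iff.2 hd]
      rw [h] at this
      exact this
    simp [this]
  · obtain ⟨e, he, hmin⟩ := (isCompact_sphere (0 : EuclideanSpace ℝ (Fin p)) 1).exists_isMinOn h
      (f := fun d => ⟪d, Matrix.toEuclideanCLM (𝕜 := ℝ) D d⟫) (by fun_prop)
    have hpos : ∀ d : EuclideanSpace ℝ (Fin p), d ≠ 0 →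
        0 < ⟪d, Matrix.toEuclideanCLM (𝕜 := ℝ) D d⟫ := by
      intro d hd
      rw [Matrix.inner_toEuclideanCLM]
      exact hD.dotProduct_mulVec_pos (x := d.ofLp) (by simpa using hd)
    refine ⟨_, hpos e (by rintro rfl; simp at he), fun d => ?_⟩
    rcases eq_or_ne d 0 with rfl | hd
    · simp
    · have hn : ‖d‖ ≠ 0 := norm_ne_zero_iff.2 hd
      have hmem : ‖d‖⁻¹ • d ∈ Metric.sphere (0 : EuclideanSpace ℝ (Fin p)) 1 := by
        simp [norm_smul, hn]
      have h1 := hmin hmem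
      simp only [Set.mem_ofPred_eq, map_smul, real_inner_smul_left, real_inner_smul_right] at h1
      calc _ ≤ (‖d‖⁻¹ * (‖d‖⁻¹ * ⟪d, Matrix.toEuclideanCLM (𝕜 := ℝ) D d⟫)) * ‖d‖ ^ 2 := by
            gcongr
        _ = _ := by field_simp

/-- Coercivity survives small perturbations, at the price of half the constant. -/
theorem coercive_of_norm_sub_lt {V : Type*} [NormedAddCommGroup V] [InnerProductSpace ℝ V]
    {D C : V →L[ℝ] V} {c : ℝ} (hD : ∀ d, c * ‖d‖ ^ 2 ≤ ⟪d, D d⟫) (h : ‖D - C‖ < c / 2) (d : V) :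
    c / 2 * ‖d‖ ^ 2 ≤ ⟪d, C d⟫ := by
  have h1 : ⟪d, C d⟫ = ⟪d, D d⟫ - ⟪d, (D - C) d⟫ := by
    rw [_root_.sub_apply, inner_sub_right]
    ring
  have h2 : ⟪d, (D - C) d⟫ ≤ c / 2 * ‖d‖ ^ 2 := by
    calc ⟪d, (D - C) d⟫ ≤ ‖d‖ * ‖(D - C) d‖ := real_inner_le_norm _ _
      _ ≤ ‖d‖ * (‖D - C‖ * ‖d‖) := by
          gcongr
          exact (D - C).le_opNorm d
      _ ≤ ‖d‖ * (c / 2 * ‖d‖) := by gcongr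
      _ = _ := by ring
  linarith [hD d]

theorem inner_toEuclideanCLM_comm {p : ℕ} {C : Matrix (Fin p) (Fin p) ℝ} (hC : C.IsSymm)
    (x y : EuclideanSpace ℝ (Fin p)) :
    ⟪Matrix.toEuclideanCLM (𝕜 := ℝ) C x, y⟫ = ⟪x, Matrix.toEuclideanCLM (𝕜 := ℝ) C y⟫ := by
  rw [real_inner_comm, Matrix.inner_toEuclideanCLM, Matrix.inner_toEuclideanCLM,
    dotProduct_mulVec_comm_of_isSymm hC]

theorem curvature_isSymm {n p : ℕ} {B : Matrix (Fin n) (Fin n) ℝ} (hB : B.IsSymm)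
    (Xt : Matrix (Fin n) (Fin p) ℝ) (r : EuclideanSpace ℝ (Fin n))
    (β : EuclideanSpace ℝ (Fin p)) : (curvature B Xt r β).IsSymm := by
  rw [Matrix.IsSymm, curvature]
  simp only [Matrix.transpose_sub, Matrix.transpose_smul, Matrix.transpose_mul,
    Matrix.transpose_transpose, Matrix.transpose_one, hB.eq, Matrix.mul_assoc]

theorem continuous_toEuclideanCLM (p : ℕ) : Continuous fun A : Matrix (Fin p) (Fin p) ℝ =>
    (Matrix.toEuclideanCLM (𝕜 := ℝ) A :
      EuclideanSpace ℝ (Fin p) →L[ℝ] EuclideanSpace ℝ (Fin p)) :=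
  LinearMap.continuous_of_finiteDimensional
    ((Matrix.toEuclideanCLM (n := Fin p) (𝕜 := ℝ)).toAlgEquiv.toLinearEquiv.toLinearMap)

/-- Convergence in distribution depends on the limit only through its law. -/
theorem tendstoInDistribution_of_map_eq {E Ω Ω' Ω'' : Type*} [TopologicalSpace E]
    [MeasurableSpace E] [OpensMeasurableSpace E] [MeasurableSpace Ω] [MeasurableSpace Ω']
    [MeasurableSpace Ω''] {P : Measure Ω} [IsProbabilityMeasure P] {P' : Measure Ω'}
    [IsProbabilityMeasure P'] {P'' : Measure Ω''} [IsProbabilityMeasure P''] {U : ℕ → Ω → E}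
    {Z : Ω' → E} {Z' : Ω'' → E} (h : TendstoInDistribution U atTop Z (fun _ => P) P')
    (hZ' : AEMeasurable Z' P'') (hmap : P'.map Z = P''.map Z') :
    TendstoInDistribution U atTop Z' (fun _ => P) P'' := by
  refine ⟨h.forall_aemeasurable, hZ', ?_⟩
  have h2 := h.tendsto
  simp only [hmap] at h2
  exact h2

/-- The image of a centred Gaussian law under a matrix. -/
theorem multivariateGaussian_map {p : ℕ} {S : Matrix (Fin p) (Fin p) ℝ} (hS : S.PosSemidef)
    (A : Matrix (Fin p) (Fin p) ℝ) :
    (multivariateGaussian 0 S).map (Matrix.toEuclideanCLM (𝕜 := ℝ) A) =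
      multivariateGaussian 0 (A * S * A.transpose) := by
  have hS' : (A * S * A.transpose).PosSemidef := by
    simpa using hS.mul_mul_conjTranspose_same A
  refine Measure.ext_of_charFun (funext fun t => ?_)
  have h1 : charFun ((multivariateGaussian 0 S).map (Matrix.toEuclideanCLM (𝕜 := ℝ) A)) t =
      charFun (multivariateGaussian 0 S)
        (Matrix.toEuclideanCLM (𝕜 := ℝ) A.transpose t) := by
    rw [charFun_apply, charFun_apply, integral_map (by fun_prop)
      (Continuous.aestronglyMeasurable (by fun_prop))]
    congr 1
    ext x
    rw [real_inner_comm, Matrix.inner_toEuclideanCLM, inner_eq_dotProduct,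
      Matrix.ofLp_toEuclideanCLM, Matrix.mulVec_transpose, Matrix.dotProduct_mulVec,
      dotProduct_comm]
  rw [h1, charFun_multivariateGaussian hS, charFun_multivariateGaussian hS']
  simp only [inner_zero_right, Complex.ofReal_zero, zero_mul, zero_sub]
  congr 4
  rw [Matrix.ofLp_toEuclideanCLM, mulVec_dotProduct_mulVec_mulVec, Matrix.transpose_transpose]

variable {Ω : Type*} [MeasurableSpace Ω] {P : Measure Ω} [IsProbabilityMeasure P] {p : ℕ}
  {N : ℕ → ℕ} {X : ∀ k, Matrix (Fin (N k)) (Fin p) ℝ}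
  {Sig : ∀ k, Matrix (Fin (N k)) (Fin (N k)) ℝ}
  {η : ∀ k, Option (Fin p) → Ω → EuclideanSpace ℝ (Fin (N k))}
  {B : ∀ k, Ω → Matrix (Fin (N k)) (Fin (N k)) ℝ}
  {Δ₁ Δ₂ : Matrix (Fin p) (Fin p) ℝ} {δ K : ℝ}

namespace PrecisionModel

/-- The curvature matrix of the model. -/
noncomputable abbrev modelCurvature {Ω : Type*} (X : ∀ k, Matrix (Fin (N k)) (Fin p) ℝ)
    (η : ∀ k, Option (Fin p) → Ω → EuclideanSpace ℝ (Fin (N k)))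
    (B : ∀ k, Ω → Matrix (Fin (N k)) (Fin (N k)) ℝ) (β : EuclideanSpace ℝ (Fin p)) (k : ℕ)
    (ω : Ω) : Matrix (Fin p) (Fin p) ℝ :=
  curvature (B k ω) (observed (X k) fun i => η k (some i) ω) (comb (η k) (residCoef β) ω) β

theorem aemeasurable_modelCurvature {P : Measure Ω}
    (M : PrecisionModel P N X Sig η B Δ₁ Δ₂ δ K)
    (β : EuclideanSpace ℝ (Fin p)) (k : ℕ) : AEMeasurable (modelCurvature X η B β k) P := by
  have h1 : Continuous fun q : Matrix (Fin (N k)) (Fin (N k)) ℝ ×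
      (Option (Fin p) → EuclideanSpace ℝ (Fin (N k))) =>
      observed (X k) fun i => q.2 (some i) := by
    refine continuous_matrix fun i j => ?_
    simp only [observed, Matrix.of_apply]
    fun_prop
  have h2 : Continuous fun q : Matrix (Fin (N k)) (Fin (N k)) ℝ ×
      (Option (Fin p) → EuclideanSpace ℝ (Fin (N k))) =>
      curvature q.1 (observed (X k) fun i => q.2 (some i)) (∑ o, residCoef β o • q.2 o) β := by
    unfold curvature lamHat
    fun_prop
  have h3 : AEMeasurable (fun ω => (B k ω, fun o => η k o ω)) P := (M.aemeasurable k).prodMk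
    (aemeasurable_pi_lambda _ fun o => (M.hasLaw k o).aemeasurable)
  have h4 := h2.measurable.comp_aemeasurable h3
  simp only [Function.comp_def] at h4
  exact h4

theorem lim_norm_sub_modelCurvature (M : PrecisionModel P N X Sig η B Δ₁ Δ₂ δ K)
    (β : EuclideanSpace ℝ (Fin p)) :
    TendstoInMeasure P (fun k ω => ‖Matrix.toEuclideanCLM (𝕜 := ℝ) Δ₁ -
      Matrix.toEuclideanCLM (𝕜 := ℝ) (modelCurvature X η B β k ω)‖) atTop (fun _ => 0) := by
  have h : TendstoInMeasure P (fun k ω i j => modelCurvature X η B β k ω i j) atTop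
      (fun _ i j => Δ₁ i j) :=
    tendstoInProb_pi fun i => tendstoInProb_pi fun j => M.lim_curvature β i j
  have hc : Continuous fun A : Fin p → Fin p → ℝ => ‖Matrix.toEuclideanCLM (𝕜 := ℝ) Δ₁ -
      Matrix.toEuclideanCLM (𝕜 := ℝ) (Matrix.of A)‖ :=
    (continuous_const.sub ((continuous_toEuclideanCLM p).comp
      (continuous_id : Continuous fun A : Fin p → Fin p → ℝ => A))).norm
  have h2 := tendstoInProb_continuousAt h hc.continuousAt
  have e : ‖Matrix.toEuclideanCLM (𝕜 := ℝ) Δ₁ -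
      Matrix.toEuclideanCLM (𝕜 := ℝ) (Matrix.of fun i j => Δ₁ i j)‖ = 0 := by
    rw [norm_eq_zero, sub_eq_zero]
    rfl
  rw [e] at h2
  exact h2

/-- The score itself tends to zero in probability. -/
theorem lim_norm_modelScore (M : PrecisionModel P N X Sig η B Δ₁ Δ₂ δ K)
    (hK : 0 ≤ K) (hΔ₂ : Δ₂.PosSemidef) (β : EuclideanSpace ℝ (Fin p)) :
    TendstoInMeasure P (fun k ω => ‖modelScore X η B β k ω‖) atTop (fun _ => 0) := by
  have hv : Tendsto (fun k => (√(N k : ℝ))⁻¹) atTop (𝓝 0) :=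
    tendsto_inv_atTop_zero.comp (Real.tendsto_sqrt_atTop.comp
      (tendsto_natCast_atTop_atTop.comp M.tendsto_dim))
  have h := tendstoInProb_norm_mul_of_tendstoInDistribution
    (M.tendstoInDistribution_modelScore hK hΔ₂ β) (tendstoInProb_of_tendsto (P := P) hv)
    (fun _ => aemeasurable_const)
  refine h.congr' ?_ ae_eq_rfl
  filter_upwards [M.tendsto_dim.eventually_gt_atTop 0] with k hk
  refine ae_of_all _ fun ω => ?_
  have hpos : (0 : ℝ) < √(N k : ℝ) := Real.sqrt_pos.2 (by exact_mod_cast hk)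
  simp only
  rw [norm_smul, Real.norm_of_nonneg hpos.le]
  field_simp

/-- Asymptotic normality of any sequence that eventually minimizes the recentred objective: it is
asymptotically equivalent to the Gaussian linearization `Δ₁⁻¹ √N h`. -/
theorem tendstoInDistribution_of_isMin (M : PrecisionModel P N X Sig η B Δ₁ Δ₂ δ K)
    (hK : 0 ≤ K) (hΔ₁ : Δ₁.PosDef) (hΔ₂ : Δ₂.PosSemidef) {β : EuclideanSpace ℝ (Fin p)}
    {c : ℝ} (hc : 0 < c) (hcoer : ∀ d : EuclideanSpace ℝ (Fin p),
      c * ‖d‖ ^ 2 ≤ ⟪d, Matrix.toEuclideanCLM (𝕜 := ℝ) Δ₁ d⟫)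
    {d : ∀ _ : ℕ, Ω → EuclideanSpace ℝ (Fin p)} (hdm : ∀ k, AEMeasurable (d k) P)
    (hd : ∀ᶠ k in atTop, ∀ᵐ ω ∂P, ‖Matrix.toEuclideanCLM (𝕜 := ℝ) Δ₁ -
      Matrix.toEuclideanCLM (𝕜 := ℝ) (modelCurvature X η B β k ω)‖ < c / 2 →
      ∀ d', recentred (Matrix.toEuclideanCLM (𝕜 := ℝ) (modelCurvature X η B β k ω))
        (modelScore X η B β k ω) β (d k ω) ≤
        recentred (Matrix.toEuclideanCLM (𝕜 := ℝ) (modelCurvature X η B β k ω))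
        (modelScore X η B β k ω) β d') :
    TendstoInDistribution (fun k ω => √(N k : ℝ) • d k ω) atTop id (fun _ => P)
      (multivariateGaussian 0 (asymCov Δ₁ Δ₂ K β)) := by
  set T := Matrix.toEuclideanCLM (𝕜 := ℝ) Δ₁⁻¹ with hT
  set D := Matrix.toEuclideanCLM (𝕜 := ℝ) Δ₁ with hD
  have hTD : ∀ x, T (D x) = x := by
    intro x
    have hdet : IsUnit Δ₁.det := hΔ₁.det_pos.ne'.isUnit
    rw [hT, hD, ← mul_apply_eq_comp, ← map_mul, Matrix.nonsing_inv_mul _ hdet,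
      map_one, one_apply_eq_self]
  have hscore := M.tendstoInDistribution_modelScore hK hΔ₂ β
  have hlin := hscore.continuous_comp T.continuous
  -- The relative error of the linearization `d ≈ Δ₁⁻¹ h`.
  set ρ : ℕ → Ω → ℝ := fun k ω => ‖T‖ * (‖modelScore X η B β k ω‖ / (c / 2) *
    (‖β‖ + 2 * ‖modelScore X η B β k ω‖ / (c / 2)) +
    ‖D - Matrix.toEuclideanCLM (𝕜 := ℝ) (modelCurvature X η B β k ω)‖ * (2 / (c / 2))) with hρ
  have hρ0 : TendstoInMeasure P ρ atTop (fun _ => 0) := by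
    have h := tendstoInProb_prodMk (M.lim_norm_modelScore hK hΔ₂ β)
      (M.lim_norm_sub_modelCurvature β)
    have hg : Continuous fun x : ℝ × ℝ => ‖T‖ * (x.1 / (c / 2) * (‖β‖ + 2 * x.1 / (c / 2)) +
        x.2 * (2 / (c / 2))) := by fun_prop
    have h2 := tendstoInProb_continuousAt h hg.continuousAt
    simpa using h2
  have hρm : ∀ k, AEMeasurable (ρ k) P := by
    intro k
    have h1 := (M.aemeasurable_modelScore β k).norm
    have h2 : AEMeasurable (fun ω =>
        ‖D - Matrix.toEuclideanCLM (𝕜 := ℝ) (modelCurvature X η B β k ω)‖) P :=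
      ((continuous_const.sub (continuous_toEuclideanCLM p)).norm.measurable).comp_aemeasurable
        (M.aemeasurable_modelCurvature β k)
    exact (((h1.div_const _).mul (aemeasurable_const.add
      ((h1.const_mul 2).div_const _))).add (h2.mul_const _)).const_mul _
  have hY : ∀ k, AEMeasurable (fun ω => √(N k : ℝ) • d k ω) P := fun k =>
    (hdm k).const_smul (√(N k : ℝ))
  -- `√N h` is stochastically bounded, so the error `‖√N h‖ ρ` is negligible.
  have herr := tendstoInProb_norm_mul_of_tendstoInDistribution hscore hρ0 hρm
  have hbad := tendsto_measure_notMem_of_tendstoInProb (M.lim_norm_sub_modelCurvature β)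
    (Iio_mem_nhds (half_pos hc))
  have hfin := tendstoInDistribution_of_tendstoInMeasure_sub (μ'' := P)
    (fun k ω => √(N k : ℝ) • d k ω) _ hlin (tendstoInProb_zero_of_le herr hbad ?_) hY
  · have hlaw : (multivariateGaussian 0 (scoreCov Δ₂ K β)).map (T ∘ id) =
        (multivariateGaussian 0 (asymCov Δ₁ Δ₂ K β)).map id := by
      rw [Function.comp_id, hT, multivariateGaussian_map (posSemidef_scoreCov hΔ₂ hK β),
        Measure.map_id, asymCov, scoreCov]
      congr 2
      have : Δ₁.transpose = Δ₁ := by simpa using hΔ₁.1.eq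
      rw [Matrix.transpose_nonsing_inv, this]
    exact tendstoInDistribution_of_map_eq hfin aemeasurable_id hlaw
  · filter_upwards [hd, M.tendsto_dim.eventually_gt_atTop 0] with k hk hkN
    filter_upwards [hk, M.posDef k] with ω hω hB hgood
    have hlt : ‖D - Matrix.toEuclideanCLM (𝕜 := ℝ) (modelCurvature X η B β k ω)‖ < c / 2 := by
      by_contra hcon
      exact hgood hcon
    have hsym := inner_toEuclideanCLM_comm (curvature_isSymm (by simpa using hB.1 :
      (B k ω).IsSymm) (observed (X k) fun i => η k (some i) ω) (comb (η k) (residCoef β) ω) β)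
    have h1 := norm_apply_sub_le_of_isMin D hsym (half_pos hc)
      (coercive_of_norm_sub_lt hcoer hlt) (hω hlt)
    have h2 : (fun ω => √(N k : ℝ) • d k ω) ω -
        (T ∘ fun ω => √(N k : ℝ) • modelScore X η B β k ω) ω =
        √(N k : ℝ) • T (D (d k ω) - modelScore X η B β k ω) := by
      simp only [Function.comp, map_smul, map_sub, hTD, smul_sub]
    change ‖(fun ω => √(N k : ℝ) • d k ω) ω -
        (T ∘ fun ω => √(N k : ℝ) • modelScore X η B β k ω) ω‖ ≤ _
    rw [h2, norm_smul, norm_smul, hρ]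
    calc _ ≤ ‖√(N k : ℝ)‖ * (‖T‖ * (‖modelScore X η B β k ω‖ *
          (‖modelScore X η B β k ω‖ / (c / 2) *
            (‖β‖ + 2 * ‖modelScore X η B β k ω‖ / (c / 2)) +
            ‖D - Matrix.toEuclideanCLM (𝕜 := ℝ) (modelCurvature X η B β k ω)‖ *
              (2 / (c / 2))))) := by
          gcongr
          exact (T.le_opNorm _).trans (by gcongr)
      _ = _ := by ring

end PrecisionModel

end Linearization

/-! ### Whitened traces and the precision model -/

section Whitened

attribute [local instance] matrixMeasurableSpace matrix_borelSpace matrix_secondCountable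

open scoped MatrixOrder RealInnerProductSpace

theorem trace_whitened_sq {n : ℕ} {S Sig : Matrix (Fin n) (Fin n) ℝ} (hS : S.PosDef) :
    (whitened S Sig ^ 2).trace = (S⁻¹ * Sig * S⁻¹ * Sig).trace := by
  rw [← invSqrt_mul_invSqrt hS, whitened, pow_two]
  set W := invSqrt S
  rw [show W * Sig * W * (W * Sig * W) = W * (Sig * W * W * Sig * W) by
    simp only [mul_assoc], Matrix.trace_mul_comm,
    show Sig * W * W * Sig * W * W = Sig * (W * W * Sig * (W * W)) by simp only [mul_assoc],
    Matrix.trace_mul_comm]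

theorem trace_whitened_fourth {n : ℕ} {S Sig : Matrix (Fin n) (Fin n) ℝ} (hS : S.PosDef) :
    (whitened S Sig ^ 2 * whitened S Sig ^ 2).trace =
      (S⁻¹ * Sig * S⁻¹ * Sig * (S⁻¹ * Sig * S⁻¹ * Sig)).trace := by
  rw [← invSqrt_mul_invSqrt hS, whitened, pow_two]
  set W := invSqrt S
  rw [show W * Sig * W * (W * Sig * W) * (W * Sig * W * (W * Sig * W)) =
      W * (Sig * W * W * Sig * W * W * Sig * W * W * Sig * W) by simp only [mul_assoc],
    Matrix.trace_mul_comm,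
    show Sig * W * W * Sig * W * W * Sig * W * W * Sig * W * W =
      Sig * (W * W * Sig * (W * W) * Sig * (W * W) * Sig * (W * W)) by simp only [mul_assoc],
    Matrix.trace_mul_comm]
  simp only [mul_assoc]

theorem trace_mul_self_eq_sum {n : ℕ} {A : Matrix (Fin n) (Fin n) ℝ} (hA : A.IsSymm) :
    (A * A).trace = ∑ j, ‖Matrix.toEuclideanCLM (𝕜 := ℝ) A (EuclideanSpace.single j 1)‖ ^ 2 := by
  conv_lhs => rw [← hA.eq]
  rw [Matrix.trace]
  refine Finset.sum_congr rfl fun j _ => ?_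
  rw [EuclideanSpace.real_norm_sq_eq, Matrix.diag_apply, Matrix.mul_apply]
  refine Finset.sum_congr rfl fun i _ => ?_
  rw [Matrix.ofLp_toEuclideanCLM]
  simp [pow_two, hA.apply i j]

/-- `tr A⁴ ≤ ‖A‖² tr A²`: apply `A` once more to the columns of `A`. -/
theorem trace_fourth_le {n : ℕ} {A : Matrix (Fin n) (Fin n) ℝ} (hA : A.IsSymm) :
    (A ^ 2 * A ^ 2).trace ≤ specNorm A ^ 2 * (A ^ 2).trace := by
  have hA2 : (A ^ 2).IsSymm := by rw [Matrix.IsSymm, Matrix.transpose_pow, hA.eq]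
  rw [trace_mul_self_eq_sum hA2, pow_two A, trace_mul_self_eq_sum hA, Finset.mul_sum]
  refine Finset.sum_le_sum fun j _ => ?_
  rw [map_mul, mul_apply_eq_comp, ← mul_pow, specNorm]
  gcongr
  exact ContinuousLinearMap.le_opNorm _ _

theorem trace_fourth_nonneg {n : ℕ} {A : Matrix (Fin n) (Fin n) ℝ} (hA : A.IsSymm) :
    0 ≤ (A ^ 2 * A ^ 2).trace := by
  have hA2 : (A ^ 2).IsSymm := by rw [Matrix.IsSymm, Matrix.transpose_pow, hA.eq]
  rw [trace_mul_self_eq_sum hA2]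
  positivity

theorem whitened_isSymm {n : ℕ} {S Sig : Matrix (Fin n) (Fin n) ℝ} (hSig : Sig.IsHermitian) :
    (whitened S Sig).IsSymm := by
  have hW : (invSqrt S).transpose = invSqrt S := by simpa using (invSqrt_isHermitian S).eq
  have hs : Sig.transpose = Sig := by simpa using hSig.eq
  rw [Matrix.IsSymm, whitened, Matrix.transpose_mul, Matrix.transpose_mul, hW, hs, mul_assoc]

theorem measurable_matrix_inv (n : ℕ) :
    Measurable fun A : Matrix (Fin n) (Fin n) ℝ => A⁻¹ := by
  have h1 : Continuous fun A : Matrix (Fin n) (Fin n) ℝ => A.det := by fun_prop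
  have h2 : Continuous fun A : Matrix (Fin n) (Fin n) ℝ => A.adjugate := by fun_prop
  refine measurable_pi_lambda _ fun i => measurable_pi_lambda _ fun j => ?_
  simp only [Matrix.inv_def, Ring.inverse_eq_inv', Matrix.smul_apply, smul_eq_mul]
  exact h1.measurable.inv.mul (h2.matrix_elem i j).measurable

/-- The spectral norm condition makes the variance of the quadratic form with kernel
`B Σ B` negligible. -/
theorem lim_trace_fourth_of_specNorm {Ω : Type*} [MeasurableSpace Ω] {P : Measure Ω} {N : ℕ → ℕ}
    {Sig : ∀ k, Matrix (Fin (N k)) (Fin (N k)) ℝ} (hSig : ∀ k, (Sig k).PosSemidef)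
    {S : ∀ k, Ω → Matrix (Fin (N k)) (Fin (N k)) ℝ} (hSpos : ∀ k, ∀ᵐ ω ∂P, (S k ω).PosDef)
    {K : ℝ} (hlim₃ : TendstoInMeasure P
      (fun k ω => ((whitened (S k ω) (Sig k)) ^ 2).trace / (N k : ℝ)) atTop (fun _ => K))
    (hnorm : TendstoInMeasure P
      (fun k ω => specNorm (whitened (S k ω) (Sig k)) / √(N k : ℝ)) atTop (fun _ => (0 : ℝ))) :
    TendstoInMeasure P (fun k ω => ((N k : ℝ) ^ 2)⁻¹ *
      ((S k ω)⁻¹ * Sig k * (S k ω)⁻¹ * Sig k *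
        ((S k ω)⁻¹ * Sig k * (S k ω)⁻¹ * Sig k)).trace) atTop (fun _ => 0) := by
  have h := tendstoInProb_mul (tendstoInProb_mul hnorm hnorm) hlim₃
  rw [mul_zero, zero_mul] at h
  refine tendstoInProb_zero_of_le (bad := fun _ => ∅) h (by simp)
    (Eventually.of_forall fun k => ?_)
  filter_upwards [hSpos k] with ω hω _
  have hsym := whitened_isSymm (S := S k ω) (hSig k).1
  rw [← trace_whitened_fourth hω, Real.norm_of_nonneg
    (mul_nonneg (by positivity) (trace_fourth_nonneg hsym))]
  have e : specNorm (whitened (S k ω) (Sig k)) / √(N k : ℝ) *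
      (specNorm (whitened (S k ω) (Sig k)) / √(N k : ℝ)) *
      ((whitened (S k ω) (Sig k) ^ 2).trace / (N k : ℝ)) = ((N k : ℝ) ^ 2)⁻¹ *
      (specNorm (whitened (S k ω) (Sig k)) ^ 2 * (whitened (S k ω) (Sig k) ^ 2).trace) := by
    rw [div_mul_div_comm, Real.mul_self_sqrt (Nat.cast_nonneg _), div_mul_div_comm, ← pow_two,
      ← pow_two, div_eq_inv_mul]
  rw [e]
  gcongr
  exact trace_fourth_le hsym

/-- The hypotheses on the estimated covariance `S`, expressed through the precision matrix. -/
theorem precisionModel_inv {Ω : Type*} [MeasurableSpace Ω] {P : Measure Ω}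
    {p : ℕ} {N n : ℕ → ℕ} (hN : Tendsto N atTop atTop)
    {X : ∀ k, Matrix (Fin (N k)) (Fin p) ℝ}
    {Sig : ∀ k, Matrix (Fin (N k)) (Fin (N k)) ℝ} (hSig : ∀ k, (Sig k).PosSemidef)
    {ε : ∀ k, Ω → EuclideanSpace ℝ (Fin (N k))}
    {ν : ∀ k, Fin p → Ω → EuclideanSpace ℝ (Fin (N k))}
    (hε : ∀ k, HasLaw (ε k) (multivariateGaussian 0 (Sig k)) P)
    (hν : ∀ k i, HasLaw (ν k i) (multivariateGaussian 0 (Sig k)) P)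
    (hindep : ∀ k, iIndepFun (fun o : Option (Fin p) => o.elim (ε k) (ν k)) P)
    {Z : ∀ k, Fin (n k) → Ω → EuclideanSpace ℝ (Fin (N k))}
    (hZ : ∀ k j, AEMeasurable (Z k j) P)
    (hZindep : ∀ k, IndepFun (fun ω j => Z k j ω) (fun ω => (ε k ω, fun i => ν k i ω)) P)
    {est : ∀ k, (Fin (n k) → EuclideanSpace ℝ (Fin (N k))) →
      Matrix (Fin (N k)) (Fin (N k)) ℝ}
    (hest : ∀ k i j, Measurable (fun z => est k z i j))
    {S : ∀ k, Ω → Matrix (Fin (N k)) (Fin (N k)) ℝ}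
    (hS : ∀ k ω, S k ω = est k (fun j => Z k j ω))
    (hSpos : ∀ k, ∀ᵐ ω ∂P, (S k ω).PosDef)
    {Δ₁ Δ₂ : Matrix (Fin p) (Fin p) ℝ} {δ K : ℝ}
    (hlim₁ : TendstoInProbMatrix P
      (fun k ω => (N k : ℝ)⁻¹ • ((X k).transpose * (S k ω)⁻¹ * X k)) Δ₁)
    (hlim₂ : TendstoInMeasure P
      (fun k ω => ((S k ω)⁻¹ * Sig k).trace / (N k : ℝ)) atTop (fun _ => δ))
    (hlim₃ : TendstoInMeasure P
      (fun k ω => ((whitened (S k ω) (Sig k)) ^ 2).trace / (N k : ℝ)) atTop (fun _ => K))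
    (hlim₄ : TendstoInProbMatrix P
      (fun k ω => (N k : ℝ)⁻¹ •
        ((X k).transpose * (S k ω)⁻¹ * Sig k * (S k ω)⁻¹ * X k)) Δ₂)
    (hnorm : TendstoInMeasure P
      (fun k ω => specNorm (whitened (S k ω) (Sig k)) / √(N k : ℝ)) atTop
      (fun _ => (0 : ℝ))) :
    PrecisionModel P N X Sig (fun k o => o.elim (ε k) (ν k)) (fun k ω => (S k ω)⁻¹)
      Δ₁ Δ₂ δ K := by
  have hestm : ∀ k, Measurable fun z => (est k z)⁻¹ := fun k =>
    (measurable_matrix_inv _).comp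
      (measurable_pi_lambda _ fun i => measurable_pi_lambda _ fun j => hest k i j)
  have hSeq : ∀ k, (fun ω => (S k ω)⁻¹) = (fun z => (est k z)⁻¹) ∘ fun ω j => Z k j ω :=
    fun k => funext fun ω => by simp only [Function.comp, hS]
  refine ⟨hN, hSig, ?_, hindep, ?_, ?_, ?_, hlim₁, ?_, ?_, hlim₄,
    lim_trace_fourth_of_specNorm hSig hSpos hlim₃ hnorm⟩
  · rintro k (_ | i)
    · exact hε k
    · exact hν k i
  · intro k
    rw [hSeq]
    exact (hestm k).comp_aemeasurable (aemeasurable_pi_lambda _ fun j => hZ k j)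
  · intro k
    have hg : Measurable fun q : EuclideanSpace ℝ (Fin (N k)) ×
        (Fin p → EuclideanSpace ℝ (Fin (N k))) => fun o : Option (Fin p) => o.elim q.1 q.2 := by
      refine measurable_pi_lambda _ fun o => ?_
      cases o with
      | none => exact measurable_fst
      | some i => exact (measurable_pi_apply i).comp measurable_snd
    have h := (hZindep k).comp (hestm k) hg
    rw [hSeq]
    convert h using 1
    ext ω o
    cases o <;> rfl
  · intro k
    filter_upwards [hSpos k] with ω hω using hω.inv
  · refine hlim₂.congr_left fun k => ae_of_all _ fun ω => ?_
    simp only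
    rw [div_eq_inv_mul]
  · refine hlim₃.congr_left fun k => ?_
    filter_upwards [hSpos k] with ω hω
    rw [trace_whitened_sq hω, div_eq_inv_mul]

/-- Minimizers of the total least squares objective are the minimizers of the recentred objective,
shifted by the true parameter. -/
theorem isEstimate_add_iff {n p : ℕ} (hn : 0 < n) {S : Matrix (Fin n) (Fin n) ℝ} (hS : S.PosDef)
    {Xt : Matrix (Fin n) (Fin p) ℝ} {Y r : EuclideanSpace ℝ (Fin n)}
    {β : EuclideanSpace ℝ (Fin p)} (hr : r.ofLp = Y.ofLp - Xt.mulVec β.ofLp)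
    (d : EuclideanSpace ℝ (Fin p)) :
    IsEstimate S Xt Y (β + d) ↔
      ∀ d', recentred (Matrix.toEuclideanCLM (𝕜 := ℝ) (curvature S⁻¹ Xt r β))
        (score S⁻¹ Xt r β) β d ≤
        recentred (Matrix.toEuclideanCLM (𝕜 := ℝ) (curvature S⁻¹ Xt r β))
        (score S⁻¹ Xt r β) β d' := by
  have hn' : (0 : ℝ) < n := by exact_mod_cast hn
  refine ⟨fun h d' => ?_, fun h b => ?_⟩
  · have := h (β + d')
    rw [objective_eq_recentred hn hS Xt Y r β _ hr, objective_eq_recentred hn hS Xt Y r β _ hr]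
      at this
    linarith [le_of_mul_le_mul_left this hn']
  · rw [show b = β + (b - β) by abel, objective_eq_recentred hn hS Xt Y r β _ hr,
      objective_eq_recentred hn hS Xt Y r β _ hr]
    have := h (b - β)
    gcongr

theorem existsUnique_isEstimate {n p : ℕ} (hn : 0 < n) {S : Matrix (Fin n) (Fin n) ℝ}
    (hS : S.PosDef) {Xt : Matrix (Fin n) (Fin p) ℝ} {Y r : EuclideanSpace ℝ (Fin n)}
    {β : EuclideanSpace ℝ (Fin p)} (hr : r.ofLp = Y.ofLp - Xt.mulVec β.ofLp)
    {c : ℝ} (hc0 : 0 < c) (hc : ∀ d : EuclideanSpace ℝ (Fin p), c * ‖d‖ ^ 2 ≤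
      ⟪d, Matrix.toEuclideanCLM (𝕜 := ℝ) (curvature S⁻¹ Xt r β) d⟫) :
    ∃! b, IsEstimate S Xt Y b := by
  have hB : S⁻¹.IsSymm := by simpa using hS.inv.1
  obtain ⟨d, hd, huniq⟩ := existsUnique_isMin_recentred (h := score S⁻¹ Xt r β) (β := β)
    (inner_toEuclideanCLM_comm (curvature_isSymm hB Xt r β)) hc0 hc
  refine ⟨β + d, (isEstimate_add_iff hn hS hr d).2 hd, fun b hb => ?_⟩
  have h := huniq (b - β) ((isEstimate_add_iff hn hS hr _).1 (by simpa using hb))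
  rw [← h]
  abel

end Whitened

end GTLS

theorem mainTheorem2
    {Ω : Type*} [MeasurableSpace Ω] (P : Measure Ω) [IsProbabilityMeasure P]
    (p : ℕ) (β₀ : EuclideanSpace ℝ (Fin p))
    -- the dimensions `N`, the numbers `n` of control runs, and the limiting ratio
    (N n : ℕ → ℕ) (c : ℝ) (hc : 0 < c)
    (hN : Tendsto N atTop atTop) (hn : Tendsto n atTop atTop)
    (hNn : Tendsto (fun k => (N k : ℝ) / (n k : ℝ)) atTop (𝓝 c))
    -- the true fingerprints and the error covariance matrix
    (X : ∀ k, Matrix (Fin (N k)) (Fin p) ℝ)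
    (Sig : ∀ k, Matrix (Fin (N k)) (Fin (N k)) ℝ) (hSig : ∀ k, (Sig k).PosSemidef)
    -- regression errors and measurement errors: independent centred Gaussian vectors
    (ε : ∀ k, Ω → EuclideanSpace ℝ (Fin (N k)))
    (ν : ∀ k, Fin p → Ω → EuclideanSpace ℝ (Fin (N k)))
    (hε : ∀ k, HasLaw (ε k) (multivariateGaussian 0 (Sig k)) P)
    (hν : ∀ k i, HasLaw (ν k i) (multivariateGaussian 0 (Sig k)) P)
    (hindep : ∀ k, iIndepFun (fun o : Option (Fin p) => o.elim (ε k) (ν k)) P)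
    -- the control runs, independent of the errors, and the covariance estimator built on them
    (Z : ∀ k, Fin (n k) → Ω → EuclideanSpace ℝ (Fin (N k)))
    (hZ : ∀ k j, AEMeasurable (Z k j) P)
    (hZindep : ∀ k, IndepFun (fun ω j => Z k j ω) (fun ω => (ε k ω, fun i => ν k i ω)) P)
    (est : ∀ k, (Fin (n k) → EuclideanSpace ℝ (Fin (N k))) →
      Matrix (Fin (N k)) (Fin (N k)) ℝ)
    (hest : ∀ k i j, Measurable (fun z => est k z i j))
    (S : ∀ k, Ω → Matrix (Fin (N k)) (Fin (N k)) ℝ)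
    (hS : ∀ k ω, S k ω = est k (fun j => Z k j ω))
    (hSpos : ∀ k, ∀ᵐ ω ∂P, (S k ω).PosDef)
    -- limits in probability of the normalized design, traces and weighted design
    (Δ₁ Δ₂ : Matrix (Fin p) (Fin p) ℝ) (δ K : ℝ)
    (hΔ₁ : IsUnit Δ₁.det)
    (hlim₁ : GTLS.TendstoInProbMatrix P
      (fun k ω => (N k : ℝ)⁻¹ • ((X k).transpose * (S k ω)⁻¹ * X k)) Δ₁)
    (hδ : 0 < δ)
    (hlim₂ : TendstoInMeasure P
      (fun k ω => ((S k ω)⁻¹ * Sig k).trace / (N k : ℝ)) atTop (fun _ => δ))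
    (hK : 0 < K)
    (hlim₃ : TendstoInMeasure P
      (fun k ω => ((GTLS.whitened (S k ω) (Sig k)) ^ 2).trace / (N k : ℝ)) atTop (fun _ => K))
    (hΔ₂ : IsUnit Δ₂.det)
    (hlim₄ : GTLS.TendstoInProbMatrix P
      (fun k ω => (N k : ℝ)⁻¹ •
        ((X k).transpose * (S k ω)⁻¹ * Sig k * (S k ω)⁻¹ * X k)) Δ₂)
    -- no single direction of the prewhitened error dominates
    (hnorm : TendstoInMeasure P
      (fun k ω => GTLS.specNorm (GTLS.whitened (S k ω) (Sig k)) / √(N k : ℝ)) atTop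
      (fun _ => (0 : ℝ)))
    -- the GTLS estimator: a measurable choice of a minimizer, whenever one exists
    (βhat : ∀ k, Ω → EuclideanSpace ℝ (Fin p))
    (hβmeas : ∀ k, AEMeasurable (βhat k) P)
    (hβ : ∀ k, ∀ᵐ ω ∂P,
      (∃ b, GTLS.IsEstimate (S k ω) (GTLS.observed (X k) (fun i => ν k i ω))
        (GTLS.response (X k) β₀ (ε k ω)) b) →
      GTLS.IsEstimate (S k ω) (GTLS.observed (X k) (fun i => ν k i ω))
        (GTLS.response (X k) β₀ (ε k ω)) (βhat k ω)) :
    -- the estimator is well defined with probability tending to one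
    Tendsto (fun k => P {ω | ¬ ∃! b,
      GTLS.IsEstimate (S k ω) (GTLS.observed (X k) (fun i => ν k i ω))
        (GTLS.response (X k) β₀ (ε k ω)) b}) atTop (𝓝 0) ∧
    -- `Ξ` is a covariance matrix, and the rescaled error converges in law to `N(0, Ξ)`
    (GTLS.asymCov Δ₁ Δ₂ K β₀).PosSemidef ∧
    TendstoInDistribution (fun k ω => √(N k : ℝ) • (βhat k ω - β₀)) atTop id (fun _ => P)
      (multivariateGaussian 0 (GTLS.asymCov Δ₁ Δ₂ K β₀)) := by
  have M := GTLS.precisionModel_inv hN hSig hε hν hindep hZ hZindep hest hS hSpos hlim₁ hlim₂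
    hlim₃ hlim₄ hnorm
  have hΔ₁' : Δ₁.PosDef := by
    refine (GTLS.posSemidef_of_tendstoInProbMatrix hlim₁ fun k => ?_).posDef_iff_det_ne_zero.2
      hΔ₁.ne_zero
    filter_upwards [hSpos k] with ω hω
    have := hω.inv.posSemidef.conjTranspose_mul_mul_same (X k)
    rw [Matrix.conjTranspose_eq_transpose_of_trivial] at this
    exact this.smul (by positivity)
  have hΔ₂' : Δ₂.PosSemidef := by
    refine GTLS.posSemidef_of_tendstoInProbMatrix hlim₄ fun k => ?_
    filter_upwards [hSpos k] with ω hω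
    have h1 := (hSig k).mul_mul_conjTranspose_same ((X k).transpose * (S k ω)⁻¹)
    have h2 : ((S k ω)⁻¹).transpose = (S k ω)⁻¹ := by simpa using hω.inv.1.eq
    rw [Matrix.conjTranspose_eq_transpose_of_trivial, Matrix.transpose_mul,
      Matrix.transpose_transpose, h2, ← Matrix.mul_assoc] at h1
    exact h1.smul (by positivity)
  obtain ⟨c₀, hc₀, hcoer⟩ := GTLS.exists_coercive_of_posDef hΔ₁'
  -- The residual at the true parameter is the combination of errors with coefficients `residCoef`.
  have hr := fun k ω => GTLS.comb_residCoef (X k) (fun o => o.elim (ε k) (ν k)) ω β₀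
  have hbad := GTLS.tendsto_measure_notMem_of_tendstoInProb (M.lim_norm_sub_modelCurvature β₀)
    (Iio_mem_nhds (half_pos hc₀))
  -- Where the curvature is close to `Δ₁` it is coercive, and the minimizer exists and is unique.
  have hgood : ∀ᶠ k in atTop, ∀ᵐ ω ∂P, ‖Matrix.toEuclideanCLM (𝕜 := ℝ) Δ₁ -
      Matrix.toEuclideanCLM (𝕜 := ℝ) (GTLS.PrecisionModel.modelCurvature X
        (fun k o => o.elim (ε k) (ν k)) (fun k ω => (S k ω)⁻¹) β₀ k ω)‖ < c₀ / 2 →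
      ∃! b, GTLS.IsEstimate (S k ω) (GTLS.observed (X k) (fun i => ν k i ω))
        (GTLS.response (X k) β₀ (ε k ω)) b := by
    filter_upwards [hN.eventually_gt_atTop 0] with k hk
    filter_upwards [hSpos k] with ω hω hlt
    exact GTLS.existsUnique_isEstimate hk hω (hr k ω) (half_pos hc₀)
      (GTLS.coercive_of_norm_sub_lt hcoer hlt)
  refine ⟨?_, ?_, ?_⟩
  · refine tendsto_of_tendsto_of_tendsto_of_le_of_le' tendsto_const_nhds hbad
      (Eventually.of_forall fun _ => zero_le) ?_
    filter_upwards [hgood] with k hk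
    refine measure_mono_ae ?_
    filter_upwards [hk] with ω hω hω2 hcon
    exact hω2 (hω hcon)
  · have h := (GTLS.posSemidef_scoreCov hΔ₂' hK.le β₀).mul_mul_conjTranspose_same Δ₁⁻¹
    rwa [hΔ₁'.inv.1.eq] at h
  · refine M.tendstoInDistribution_of_isMin hK.le hΔ₁' hΔ₂' hc₀ hcoer
      (fun k => (hβmeas k).sub_const β₀) ?_
    filter_upwards [hgood, hN.eventually_gt_atTop 0] with k hk hkN
    filter_upwards [hk, hβ k, hSpos k] with ω h1 h2 hω hlt
    refine (GTLS.isEstimate_add_iff hkN hω (hr k ω) _).1 ?_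
    rw [add_sub_cancel]
    exact h2 (h1 hlt).exists
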